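/- **Notation.** For $x>0$ let $\pi(x)$ be the number of primes $\le x$, let ${\mathbf p}(x)=\pi(x)/x$, and let $\operatorname{li}(x)=\int_0^x\frac{du}{\log u}$ (Cauchy principal value at $u=1$). Let $\mu=1.4513\ldots$ be the unique positive zero of $\operatorname{li}$, let $\gamma$ be the Euler–Mascheroni constant, and let $H_k=\sum_{j=1}^k\frac1j$. Let $\delta$ be the supremum of the real parts of the complex zeros of the Riemann zeta function. For $t,r\in\mathbb R$ and a natural number $n$ put $$S_n(t,r)=\sum_{r\le k<n}\frac{1}{H_k-\gamma+t},$$ the sum being over positive integers $k$ (a term whose denominator vanishes is read as $0$; this cannot occur when $\lceil r\rceil\ge\mu e^{-t}$), and put $$\beta(t,r)=\lim_{n\to\infty}\left(\frac{\operatorname{li}(e^tn)}{e^t}-S_n(t,r)\right).$$ **Theorem.** Suppose that $M>0$, $C\ge\mu$ and $\alpha\in\mathbb R$ are such that $|\pi(x)-\operatorname{li}(x)|\le Mx^\alpha\log x$ for all real $x\ge C$. Then $\alpha\ge\delta$. Moreover, for all $t,r\in\mathbb R$ with $\lceil r\rceil\ge\mu e^{-t}$ the limit $\beta(t,r)$ exists,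 and for all real $\lambda\ge\beta(t,r)$ and all integers $n\ge Ce^{-t}$ one has 1. $\left|\pi(e^tn)-e^tS_n(t,r)\right|<Me^{\alpha t}n^\alpha(t+\log n)+\lambda e^t$; 2. $\left|\pi(e^tn)-e^tS_n(t,r)\right|<Me^{\alpha t}n^\alpha(H_n-\gamma+t)+\lambda e^t$; 3. $\left|{\mathbf p}(e^tn)-\frac1nS_n(t,r)\right|<\frac{M}{e^{(1-\alpha)t}}\frac{t+\log n}{n^{1-\alpha}}+\frac{\lambda}{n}$; 4. $\left|{\mathbf p}(e^tn)-\frac1nS_n(t,r)\right|<\frac{M}{e^{(1-\alpha)t}}\frac{H_n-\gamma+t}{n^{1-\alpha}}+\frac{\lambda}{n}$. Conversely, if for some constants $M>0$, $C\ge\mu$, $\lambda>0$ and $t,r,\alpha\in\mathbb R$ at least one of the conditions 1–4 holds for all integers $n\ge C$, then $\alpha\ge\delta$, and there exist constants $M'>0$ and $C'\ge\mu$ such that $|\pi(x)-\operatorname{li}(x)|\le M'x^\alpha\log x$ for all real $x\ge C'$. -/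

import Mathlib

open Filter Topology

noncomputable section

namespace HarmonicPrimes

/-- The logarithmic integral `li x = ∫₀ˣ du / log u`, as a Cauchy principal value at `u = 1`:
the limit, as `ε → 0⁺`, of the integral over `(0, x]` with `(1 - ε, 1 + ε)` removed.
The limit exists for all `x > 0` with `x ≠ 1`; at `x = 1` the integrals tend to `-∞`, so the
value there is meaningless and is never used. -/
def li (x : ℝ) : ℝ :=
  limUnder (𝓝[>] (0 : ℝ)) fun ε : ℝ =>
    ∫ u in Set.Ioc 0 x \ Set.Ioo (1 - ε) (1 + ε), 1 / Real.log u

/-- The Ramanujan–Soldner constant `μ = 1.4513…`, the unique positive zero of `li`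
(the point `1` is excluded because there `li` is `-∞`, not a real number). -/
def soldner : ℝ :=
  sInf {x : ℝ | 0 < x ∧ x ≠ 1 ∧ li x = 0}

/-- The prime counting function `π x = #{p ≤ x : p prime}` of a real variable. -/
def primePi (x : ℝ) : ℝ :=
  (Nat.primeCounting ⌊x⌋₊ : ℝ)

/-- The prime density function `π x / x`. -/
def primeDensity (x : ℝ) : ℝ :=
  primePi x / x

/-- The supremum of the real parts of the complex zeros of the Riemann zeta function. -/
def zetaZeroSup : ℝ :=
  sSup {σ : ℝ | ∃ s : ℂ, riemannZeta s = 0 ∧ s.re = σ}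

/-- `H_k - γ + t`, with `H_k` the harmonic number and `γ` the Euler–Mascheroni constant. -/
def shiftedHarmonic (t : ℝ) (k : ℕ) : ℝ :=
  (harmonic k : ℝ) - Real.eulerMascheroniConstant + t

/-- The sum of `1 / (H_k - γ + t)` over the positive integers `k` with `r ≤ k < n`. -/
def harmonicSum (t r : ℝ) (n : ℕ) : ℝ :=
  ∑ k ∈ (Finset.Ico 1 n).filter (fun k : ℕ => r ≤ (k : ℝ)), 1 / shiftedHarmonic t k

/-- `β_n(t, r) = li (eᵗ n) / eᵗ - ∑_{r ≤ k < n} 1 / (H_k - γ + t)`. -/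
def betaSeq (t r : ℝ) (n : ℕ) : ℝ :=
  li (Real.exp t * n) / Real.exp t - harmonicSum t r n

/-- `β(t, r) = lim_{n → ∞} β_n(t, r)`. -/
def beta (t r : ℝ) : ℝ :=
  limUnder atTop (betaSeq t r)

/-- `|π(eᵗ n) - eᵗ ∑ 1 / (H_k - γ + t)| < M e^{αt} n^α (t + log n) + lam eᵗ`. -/
def PiLogBound (M α t r lam : ℝ) (n : ℕ) : Prop :=
  |primePi (Real.exp t * n) - Real.exp t * harmonicSum t r n| <
    M * Real.exp (α * t) * (n : ℝ) ^ α * (t + Real.log n) + lam * Real.exp t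

/-- `|π(eᵗ n) - eᵗ ∑ 1 / (H_k - γ + t)| < M e^{αt} n^α (H_n - γ + t) + lam eᵗ`. -/
def PiHarmonicBound (M α t r lam : ℝ) (n : ℕ) : Prop :=
  |primePi (Real.exp t * n) - Real.exp t * harmonicSum t r n| <
    M * Real.exp (α * t) * (n : ℝ) ^ α * shiftedHarmonic t n + lam * Real.exp t

/-- `|p(eᵗ n) - (1/n) ∑ 1 / (H_k - γ + t)| < M / e^{(1-α)t} * (t + log n) / n^{1-α} + lam / n`. -/
def DensityLogBound (M α t r lam : ℝ) (n : ℕ) : Prop :=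
  |primeDensity (Real.exp t * n) - 1 / (n : ℝ) * harmonicSum t r n| <
    M / Real.exp ((1 - α) * t) * ((t + Real.log n) / (n : ℝ) ^ (1 - α)) + lam / n

/-- `|p(eᵗ n) - (1/n) ∑ 1 / (H_k - γ + t)| < M / e^{(1-α)t} * (H_n - γ + t) / n^{1-α} + lam / n`. -/
def DensityHarmonicBound (M α t r lam : ℝ) (n : ℕ) : Prop :=
  |primeDensity (Real.exp t * n) - 1 / (n : ℝ) * harmonicSum t r n| <
    M / Real.exp ((1 - α) * t) * (shiftedHarmonic t n / (n : ℝ) ^ (1 - α)) + lam / n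

end HarmonicPrimes

end

/-! Both directions compare `e^t S_n` with `li (e^t n)`; their difference is `e^t β_n`. The
increment `β_{n+1} - β_n` is `∫_n^{n+1} du/(t + log u)` minus the term `1/(H_n - γ + t)` (present
when `r ≤ n`). By convexity the integral is at least `1/(t + log (n + 1/2))`, and `log (n + 1/2) <
H_n - γ`, so `β_n` increases strictly (`betaSeq_lt_succ`). From `H_n - γ < log (n + 1)` one gets
that `β_n + 1/(t + log n)` does not increase once `n ≥ r` (`betaSeq_succ_le`). Hence `β_n`
converges, and `0 ≤ β_n < β` when `⌈r⌉ ≥ μ e^{-t}`; the triangle inequality gives bound 1, and the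
other three follow from it.

For the converse, boundedness of `β_n` gives a bound for `π - li` at the points `e^t n`, and
monotonicity of `π` and `li` extends it to all large `x`.

That such a bound forces `α ≥ δ` goes through `θ`. Partial summation gives `θ(n) - n = O(n^b)` for
every `b > α` (with `α` first replaced by a positive exponent). Write `-ζ'/ζ - ζ = A + Q`, where `A`
has the coefficients of `θ(n) - n` and `Q` those of the higher prime powers. Then `A` is analytic
for `re s > b` and `Q` for `re s > 1/2`, so `ζ' = -ζ (ζ + A + Q)` continues past `re s = 1`, and at
a zero it would contradict the fact that differentiation lowers the order of vanishing. If `b <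
1/2`, then `Q` would stay bounded as `s` decreases to `1/2`, which the squares of primes prevent
(`not_theta_isBigO_of_lt_half`); hence `α ≥ 1/2`, and the domain of `Q` costs nothing. -/

namespace HarmonicPrimes

/-! ### The logarithmic integral and its positive zero -/

open MeasureTheory Set

/-- The function `1 / log u - 1 / (u - 1)`, which is bounded on `[0, ∞)`. -/
noncomputable def liRegular (u : ℝ) : ℝ := 1 / Real.log u - 1 / (u - 1)

lemma liRegular_mem_Icc {u : ℝ} (hu : 0 ≤ u) : liRegular u ∈ Icc (0 : ℝ) 1 := by
  unfold liRegular
  -- The default values of `log 0` and of division by zero give the value 1 at `u = 0` and 0 at `u =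
  -- 1`.
  rcases hu.eq_or_lt with rfl | hu
  · norm_num
  rcases eq_or_ne u 1 with rfl | h1
  · norm_num
  have hlu : Real.log u ≤ u - 1 := Real.log_le_sub_one_of_pos hu
  have hll : 1 - u⁻¹ ≤ Real.log u := Real.one_sub_inv_le_log_of_pos hu
  have hll' : u - 1 ≤ u * Real.log u := by
    have := mul_le_mul_of_nonneg_left hll hu.le
    rwa [mul_sub, mul_inv_cancel₀ hu.ne', mul_one] at this
  have hprod : 0 < Real.log u * (u - 1) := by
    rcases lt_or_gt_of_ne h1 with h | h
    · exact mul_pos_of_neg_of_neg (Real.log_neg hu h) (by linarith)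
    · exact mul_pos (Real.log_pos h) (by linarith)
  have hl0 : Real.log u ≠ 0 := left_ne_zero_of_mul hprod.ne'
  have hu0 : u - 1 ≠ 0 := right_ne_zero_of_mul hprod.ne'
  have : 1 / Real.log u - 1 / (u - 1) = (u - 1 - Real.log u) / (Real.log u * (u - 1)) := by
    field_simp
  rw [this]
  refine ⟨div_nonneg (by linarith) hprod.le, (div_le_one hprod).2 ?_⟩
  nlinarith

lemma measurable_liRegular : Measurable liRegular := by
  unfold liRegular
  fun_prop

lemma norm_liRegular_le {u : ℝ} (hu : 0 ≤ u) : ‖liRegular u‖ ≤ 1 := by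
  have := liRegular_mem_Icc hu
  rw [Real.norm_of_nonneg this.1]
  exact this.2

lemma integrableOn_liRegular {s : Set ℝ} (hs : MeasurableSet s) (hs0 : s ⊆ Ici 0)
    (hfin : volume s ≠ ⊤) : IntegrableOn liRegular s := by
  refine Measure.integrableOn_of_bounded hfin measurable_liRegular.aestronglyMeasurable
    (M := 1) ?_
  exact (ae_restrict_iff' hs).2 (Eventually.of_forall fun u hu => norm_liRegular_le (hs0 hu))

lemma intervalIntegrable_liRegular {a b : ℝ} (ha : 0 ≤ a) (hb : 0 ≤ b) :
    IntervalIntegrable liRegular volume a b := by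
  rw [intervalIntegrable_iff]
  refine integrableOn_liRegular measurableSet_uIoc (fun u hu => ?_) (by simp [uIoc])
  exact (le_min ha hb).trans hu.1.le

lemma one_div_log_eq (u : ℝ) : 1 / Real.log u = 1 / (u - 1) + liRegular u := by
  unfold liRegular; ring

lemma hasDerivAt_log_abs_sub_one {u : ℝ} (hu : u ≠ 1) :
    HasDerivAt (fun u => Real.log (u - 1)) (1 / (u - 1)) u :=
  ((hasDerivAt_id u).sub_const 1).log (sub_ne_zero.2 hu)

lemma intervalIntegrable_one_div_sub_one {a b : ℝ} (h : (1 : ℝ) ∉ uIcc a b) :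
    IntervalIntegrable (fun u : ℝ => 1 / (u - 1)) volume a b := by
  refine ContinuousOn.intervalIntegrable fun u hu => ContinuousAt.continuousWithinAt ?_
  have : u - 1 ≠ 0 := sub_ne_zero.2 (by rintro rfl; exact h hu)
  fun_prop (disch := assumption)

lemma integral_one_div_sub_one {a b : ℝ} (h : (1 : ℝ) ∉ uIcc a b) :
    ∫ u in a..b, 1 / (u - 1) = Real.log (b - 1) - Real.log (a - 1) :=
  intervalIntegral.integral_eq_sub_of_hasDerivAt
    (fun u hu => hasDerivAt_log_abs_sub_one (by rintro rfl; exact h hu))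
    (intervalIntegrable_one_div_sub_one h)

lemma intervalIntegrable_one_div_log {a b : ℝ} (ha : 0 ≤ a) (hb : 0 ≤ b)
    (h : (1 : ℝ) ∉ uIcc a b) :
    IntervalIntegrable (fun u : ℝ => 1 / Real.log u) volume a b := by
  simp_rw [one_div_log_eq]
  exact (intervalIntegrable_one_div_sub_one h).add (intervalIntegrable_liRegular ha hb)

/-- The singular part `1/(u - 1)` has primitive `log |u - 1|` (`Real.log` is even), and its boundary
terms `log ε` at `1 - ε` and `1 + ε` cancel. -/
lemma truncated_integral_eq {x ε : ℝ} (hε : 0 < ε) (hε1 : ε < 1) (hεx : ε < x - 1) :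
    ∫ u in Ioc 0 x \ Ioo (1 - ε) (1 + ε), 1 / Real.log u =
      Real.log (x - 1) + ((∫ u in (0 : ℝ)..(1 - ε), liRegular u) +
        ∫ u in (1 + ε)..x, liRegular u) := by
  have hset : Ioc 0 x \ Ioo (1 - ε) (1 + ε) = Ioc 0 (1 - ε) ∪ Icc (1 + ε) x := by
    ext u
    simp only [Set.mem_sdiff, mem_Ioc, mem_Ioo, mem_union, mem_Icc, not_and, not_lt]
    constructor
    · rintro ⟨⟨h0, hx⟩, h⟩
      rcases le_or_gt u (1 - ε) with h' | h'
      · exact Or.inl ⟨h0, h'⟩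
      · exact Or.inr ⟨h h', hx⟩
    · rintro (⟨h0, h1⟩ | ⟨h0, h1⟩)
      · exact ⟨⟨h0, by linarith⟩, fun h => by linarith⟩
      · exact ⟨⟨by linarith, h1⟩, fun h => h0⟩
  have hdisj : Disjoint (Ioc 0 (1 - ε)) (Icc (1 + ε) x) := by
    rw [Set.disjoint_left]
    rintro u ⟨_, h1⟩ ⟨h2, _⟩
    linarith
  have n1 : (1 : ℝ) ∉ uIcc 0 (1 - ε) := by
    rw [uIcc_of_le (by linarith)]; rintro ⟨_, h⟩; linarith
  have n2 : (1 : ℝ) ∉ uIcc (1 + ε) x := by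
    rw [uIcc_of_le (by linarith)]; rintro ⟨h, _⟩; linarith
  have i1 := intervalIntegrable_one_div_log le_rfl (by linarith) n1
  have i2 := intervalIntegrable_one_div_log (by linarith) (by linarith) n2
  rw [hset, setIntegral_union hdisj measurableSet_Icc
    ((intervalIntegrable_iff_integrableOn_Ioc_of_le (by linarith)).1 i1)
    ((intervalIntegrable_iff_integrableOn_Icc_of_le (by linarith)).1 i2),
    integral_Icc_eq_integral_Ioc, ← intervalIntegral.integral_of_le (by linarith),
    ← intervalIntegral.integral_of_le (by linarith)]
  simp_rw [one_div_log_eq]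
  rw [intervalIntegral.integral_add (intervalIntegrable_one_div_sub_one n1)
      (intervalIntegrable_liRegular le_rfl (by linarith)),
    intervalIntegral.integral_add (intervalIntegrable_one_div_sub_one n2)
      (intervalIntegrable_liRegular (by linarith) (by linarith)),
    integral_one_div_sub_one n1, integral_one_div_sub_one n2]
  have e1 : Real.log (1 - ε - 1) = Real.log ε := by
    rw [show 1 - ε - 1 = -ε by ring, Real.log_neg_eq_log]
  have e2 : Real.log (1 + ε - 1) = Real.log ε := by congr 1; ring
  rw [e1, e2]
  norm_num
  ring

/-- The principal value defining `li` exists for `x > 1`, with an explicit value. -/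
lemma tendsto_truncated_integral {x : ℝ} (hx : 1 < x) :
    Tendsto (fun ε : ℝ => ∫ u in Ioc 0 x \ Ioo (1 - ε) (1 + ε), 1 / Real.log u) (𝓝[>] 0)
      (𝓝 (Real.log (x - 1) + ∫ u in (0 : ℝ)..x, liRegular u)) := by
  have hev : ∀ᶠ ε : ℝ in 𝓝[>] 0, 0 < ε ∧ ε < 1 ∧ ε < x - 1 := by
    filter_upwards [Ioo_mem_nhdsGT (show (0 : ℝ) < min 1 (x - 1) from
      lt_min one_pos (by linarith))] with ε hε
    exact ⟨hε.1, hε.2.trans_le (min_le_left _ _), hε.2.trans_le (min_le_right _ _)⟩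
  rw [tendsto_iff_norm_sub_tendsto_zero]
  have hlim : Tendsto (fun ε : ℝ => 2 * ε) (𝓝[>] 0) (𝓝 0) := by
    have : Tendsto (fun ε : ℝ => 2 * ε) (𝓝 0) (𝓝 (2 * 0)) := by
      exact (continuous_const.mul continuous_id).tendsto _
    rw [mul_zero] at this
    exact this.mono_left nhdsWithin_le_nhds
  refine squeeze_zero' (Eventually.of_forall fun _ => norm_nonneg _) ?_ hlim
  filter_upwards [hev] with ε ⟨h0, h1, h2⟩
  rw [truncated_integral_eq h0 h1 h2]
  have ha := intervalIntegral.integral_add_adjacent_intervals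
    (intervalIntegrable_liRegular le_rfl (show (0 : ℝ) ≤ 1 - ε by linarith))
    (intervalIntegrable_liRegular (show (0 : ℝ) ≤ 1 - ε by linarith)
      (show (0 : ℝ) ≤ 1 + ε by linarith))
  have hb := intervalIntegral.integral_add_adjacent_intervals
    (intervalIntegrable_liRegular le_rfl (show (0 : ℝ) ≤ 1 + ε by linarith))
    (intervalIntegrable_liRegular (show (0 : ℝ) ≤ 1 + ε by linarith)
      (show (0 : ℝ) ≤ x by linarith))
  rw [← hb, ← ha]
  have hc : ‖∫ u in (1 - ε)..(1 + ε), liRegular u‖ ≤ 1 * |(1 + ε) - (1 - ε)| := by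
    refine intervalIntegral.norm_integral_le_of_norm_le_const fun u hu => norm_liRegular_le ?_
    rw [uIoc_of_le (by linarith)] at hu
    linarith [hu.1]
  rw [one_mul, abs_of_pos (by linarith)] at hc
  rw [show ∀ a b c d : ℝ, a + (b + d) - (a + (b + c + d)) = -c by intros; ring, norm_neg]
  linarith

lemma li_eq {x : ℝ} (hx : 1 < x) :
    li x = Real.log (x - 1) + ∫ u in (0 : ℝ)..x, liRegular u :=
  (tendsto_truncated_integral hx).limUnder_eq

lemma one_notMem_uIcc {a b : ℝ} (ha : 1 < a) (hb : 1 < b) : (1 : ℝ) ∉ uIcc a b :=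
  fun h => (lt_min ha hb).not_ge h.1

lemma li_sub_li {a b : ℝ} (ha : 1 < a) (hb : 1 < b) :
    li b - li a = ∫ u in a..b, 1 / Real.log u := by
  have n := one_notMem_uIcc ha hb
  have i := intervalIntegrable_liRegular (zero_le_one.trans ha.le) (zero_le_one.trans hb.le)
  rw [li_eq ha, li_eq hb, ← intervalIntegral.integral_add_adjacent_intervals
    (intervalIntegrable_liRegular le_rfl (zero_le_one.trans ha.le)) i]
  simp_rw [one_div_log_eq]
  rw [intervalIntegral.integral_add (intervalIntegrable_one_div_sub_one n) i,
    integral_one_div_sub_one n]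
  ring

lemma hasDerivAt_li {x : ℝ} (hx : 1 < x) : HasDerivAt li (1 / Real.log x) x := by
  have hcont : ∀ y : ℝ, 1 < y → ContinuousAt (fun u : ℝ => 1 / Real.log u) y := fun y hy => by
    have : Real.log y ≠ 0 := (Real.log_pos hy).ne'
    have : y ≠ 0 := by linarith
    fun_prop (disch := assumption)
  have hd := intervalIntegral.integral_hasDerivAt_right
    (intervalIntegrable_one_div_log (a := x) (b := x) (by linarith) (by linarith)
      (one_notMem_uIcc hx hx))
    (ContinuousAt.stronglyMeasurableAtFilter isOpen_Ioi hcont x hx) (hcont x hx)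
  refine (hd.add_const (li x)).congr_of_eventuallyEq ?_
  filter_upwards [Ioi_mem_nhds hx] with y hy
  rw [← li_sub_li hx hy]
  ring

lemma continuousOn_li : ContinuousOn li (Ioi 1) :=
  fun _ hx => (hasDerivAt_li hx).continuousAt.continuousWithinAt

lemma strictMonoOn_li : StrictMonoOn li (Ioi 1) := by
  refine strictMonoOn_of_deriv_pos (convex_Ioi 1) continuousOn_li fun x hx => ?_
  rw [interior_Ioi] at hx
  rw [(hasDerivAt_li hx).deriv]
  exact one_div_pos.2 (Real.log_pos hx)

lemma li_le_li {x y : ℝ} (hx : 1 < x) (hxy : x ≤ y) : li x ≤ li y :=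
  strictMonoOn_li.monotoneOn hx (hx.trans_le hxy) hxy

lemma li_neg_of_lt_one {x : ℝ} (h0 : 0 < x) (h1 : x < 1) : li x < 0 := by
  have hli : li x = ∫ u in (0 : ℝ)..x, 1 / Real.log u := by
    refine (Tendsto.congr' ?_ tendsto_const_nhds).limUnder_eq
    filter_upwards [Ioo_mem_nhdsGT (show (0 : ℝ) < 1 - x by linarith)] with ε hε
    rw [intervalIntegral.integral_of_le h0.le, sdiff_eq_left.2]
    rw [Set.disjoint_left]
    rintro u ⟨_, hu⟩ ⟨hu', _⟩
    linarith [hε.2]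
  have n : (1 : ℝ) ∉ uIcc 0 x := by
    rw [uIcc_of_le h0.le]; rintro ⟨_, h⟩; linarith
  have hpos : 0 < ∫ u in (0 : ℝ)..x, -(1 / Real.log u) := by
    refine intervalIntegral.intervalIntegral_pos_of_pos_on
      (intervalIntegrable_one_div_log le_rfl h0.le n).neg (fun u hu => ?_) h0
    exact neg_pos.2 (one_div_neg.2 (Real.log_neg hu.1 (hu.2.trans h1)))
  rw [intervalIntegral.integral_neg] at hpos
  linarith

lemma integral_liRegular_mem_Icc {x : ℝ} (hx : 0 ≤ x) :
    (∫ u in (0 : ℝ)..x, liRegular u) ∈ Icc 0 x := by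
  refine ⟨intervalIntegral.integral_nonneg hx fun u hu => (liRegular_mem_Icc hu.1).1, ?_⟩
  have := intervalIntegral.integral_mono_on hx (intervalIntegrable_liRegular le_rfl hx)
    (intervalIntegrable_const (c := (1 : ℝ))) fun u hu => (liRegular_mem_Icc hu.1).2
  simpa using this

lemma exists_li_eq_zero : ∃ x : ℝ, 1 < x ∧ li x = 0 := by
  -- Here `log (a - 1) = -3`, while the regular part contributes at most `a < 2`.
  set a : ℝ := 1 + Real.exp (-3) with ha
  have hexp : Real.exp (-3) < 1 := by
    rw [Real.exp_lt_one_iff]; norm_num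
  have ha1 : 1 < a := by linarith [Real.exp_pos (-3)]
  have hla : li a ≤ 0 := by
    rw [li_eq ha1, show a - 1 = Real.exp (-3) by rw [ha]; ring, Real.log_exp]
    linarith [(integral_liRegular_mem_Icc (show 0 ≤ a by linarith)).2]
  have hl2 : 0 ≤ li 2 := by
    rw [li_eq one_lt_two, show (2 : ℝ) - 1 = 1 by norm_num, Real.log_one, zero_add]
    exact (integral_liRegular_mem_Icc zero_le_two).1
  obtain ⟨x, hx, hx0⟩ := intermediate_value_Icc (show a ≤ 2 by linarith)
    (continuousOn_li.mono fun u hu => ha1.trans_le hu.1) ⟨hla, hl2⟩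
  exact ⟨x, ha1.trans_le hx.1, hx0⟩

/-- `li` is negative on `(0, 1)` and strictly increasing on `(1, ∞)`, so the set in the definition
is a singleton. -/
lemma soldner_spec : 1 < soldner ∧ li soldner = 0 := by
  obtain ⟨x, hx1, hx0⟩ := exists_li_eq_zero
  have hset : {y : ℝ | 0 < y ∧ y ≠ 1 ∧ li y = 0} = {x} := by
    ext y
    simp only [mem_ofPred_eq, mem_singleton_iff]
    constructor
    · rintro ⟨h0, h1, hy⟩
      rcases lt_or_gt_of_ne h1 with h | h
      · exact absurd hy (li_neg_of_lt_one h0 h).ne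
      · exact strictMonoOn_li.injOn h hx1 (hy.trans hx0.symm)
    · rintro rfl
      exact ⟨by linarith, hx1.ne', hx0⟩
  have : soldner = x := by rw [soldner, hset, csInf_singleton]
  rw [this]
  exact ⟨hx1, hx0⟩

lemma one_lt_soldner : 1 < soldner := soldner_spec.1

lemma li_nonneg {x : ℝ} (hx : soldner ≤ x) : 0 ≤ li x := by
  rw [← soldner_spec.2]
  exact li_le_li one_lt_soldner hx

end HarmonicPrimes

/-! ### Harmonic numbers and the sequence `β_n` -/

namespace HarmonicPrimes

open MeasureTheory Set

/-- In `log (1 + 1/a) = 2 ∑ (2a + 1)^{-(2k+1)} / (2k + 1)` with `a = n + 1/2` the first term is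
exactly `1/(n + 1)`, and the second is positive. -/
lemma one_div_lt_log_add_half_sub (n : ℕ) :
    1 / ((n : ℝ) + 1) < Real.log ((n + 1 : ℕ) + 1 / 2) - Real.log (n + 1 / 2) := by
  have ha : (0 : ℝ) < n + 1 / 2 := by positivity
  have hs := Real.hasSum_log_one_add_inv ha
  have hle := sum_le_hasSum (Finset.range 2) (fun k _ => by positivity) hs
  have hlog : Real.log (1 + (↑n + 1 / 2 : ℝ)⁻¹) =
      Real.log ((n + 1 : ℕ) + 1 / 2) - Real.log (n + 1 / 2) := by
    rw [← Real.log_div (by positivity) ha.ne']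
    congr 1
    push_cast
    field_simp
    ring
  rw [← hlog]
  refine lt_of_lt_of_le ?_ hle
  rw [Finset.sum_range_succ, Finset.sum_range_one]
  have h0 : (2 : ℝ) * (1 / (2 * (0 : ℕ) + 1)) * (1 / (2 * (↑n + 1 / 2) + 1)) ^ (2 * 0 + 1)
      = 1 / (n + 1) := by
    norm_num
    field_simp
    ring
  rw [h0]
  have : (0 : ℝ) < 2 * (1 / (2 * (1 : ℕ) + 1)) * (1 / (2 * (↑n + 1 / 2) + 1)) ^ (2 * 1 + 1) := by
    positivity
  linarith

/-- `H_n - log (n + 1/2)` decreases strictly to `γ`. -/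
lemma log_add_half_lt_harmonic_sub (n : ℕ) :
    Real.log (n + 1 / 2) < harmonic n - Real.eulerMascheroniConstant := by
  have hanti : StrictAnti fun n : ℕ => (harmonic n : ℝ) - Real.log (n + 1 / 2) := by
    refine strictAnti_nat_of_succ_lt fun n => ?_
    have := one_div_lt_log_add_half_sub n
    have h : (harmonic (n + 1) : ℝ) = harmonic n + 1 / ((n : ℝ) + 1) := by
      rw [harmonic_succ]; push_cast; rw [one_div]
    simp only [h]
    linarith
  have hlim : Tendsto (fun n : ℕ => (harmonic n : ℝ) - Real.log (n + 1 / 2)) atTop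
      (𝓝 Real.eulerMascheroniConstant) := by
    have h := Real.tendsto_harmonic_sub_log.sub
      ((Real.tendsto_log_comp_add_sub_log (1 / 2)).comp tendsto_natCast_atTop_atTop)
    rw [sub_zero] at h
    refine h.congr fun n => ?_
    simp only [Function.comp]
    ring
  have h1 := hanti (Nat.lt_succ_self n)
  have h2 := hanti.antitone.le_of_tendsto hlim (n + 1)
  simp only at h1 h2
  linarith

lemma harmonic_sub_lt_log_add_one (n : ℕ) :
    harmonic n - Real.eulerMascheroniConstant < Real.log (n + 1) := by
  have := Real.eulerMascheroniSeq_lt_eulerMascheroniConstant n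
  rw [Real.eulerMascheroniSeq] at this
  linarith

lemma add_log_lt_shiftedHarmonic (t : ℝ) {n : ℕ} (hn : 1 ≤ n) :
    t + Real.log n < shiftedHarmonic t n := by
  have h := log_add_half_lt_harmonic_sub n
  have : Real.log n ≤ Real.log (n + 1 / 2) :=
    Real.log_le_log (by exact_mod_cast hn) (by linarith)
  unfold shiftedHarmonic
  linarith

lemma log_exp_mul {t x : ℝ} (hx : 0 < x) : Real.log (Real.exp t * x) = t + Real.log x := by
  rw [Real.log_mul (Real.exp_pos t).ne' hx.ne', Real.log_exp]

lemma add_log_pos {t x : ℝ} (hx : 1 < Real.exp t * x) : 0 < t + Real.log x := by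
  have h0 : 0 < x := pos_of_mul_pos_right (zero_lt_one.trans hx) (Real.exp_pos t).le
  rw [← log_exp_mul h0]
  exact Real.log_pos hx

lemma one_lt_exp_mul_of_le {t x y : ℝ} (hx : 1 < Real.exp t * x) (hxy : x ≤ y) :
    1 < Real.exp t * y :=
  hx.trans_le (mul_le_mul_of_nonneg_left hxy (Real.exp_pos t).le)

lemma intervalIntegrable_one_div_add_log {t a b : ℝ} (ha : 1 < Real.exp t * a) (hab : a ≤ b) :
    IntervalIntegrable (fun u => 1 / (t + Real.log u)) volume a b := by
  refine ContinuousOn.intervalIntegrable fun u hu => ContinuousAt.continuousWithinAt ?_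
  rw [uIcc_of_le hab] at hu
  have h1 := one_lt_exp_mul_of_le ha hu.1
  have h2 : t + Real.log u ≠ 0 := (add_log_pos h1).ne'
  have h3 : u ≠ 0 := by rintro rfl; rw [mul_zero] at h1; linarith
  fun_prop (disch := assumption)

lemma li_exp_mul_sub {t a b : ℝ} (ha : 1 < Real.exp t * a) (hab : a ≤ b) :
    li (Real.exp t * b) / Real.exp t - li (Real.exp t * a) / Real.exp t =
      ∫ u in a..b, 1 / (t + Real.log u) := by
  rw [← sub_div, li_sub_li ha (one_lt_exp_mul_of_le ha hab),
    ← intervalIntegral.mul_integral_comp_mul_left, mul_div_cancel_left₀ _ (Real.exp_pos t).ne']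
  refine intervalIntegral.integral_congr fun u hu => ?_
  rw [uIcc_of_le hab] at hu
  have h1 := one_lt_exp_mul_of_le ha hu.1
  rw [log_exp_mul (pos_of_mul_pos_right (zero_lt_one.trans h1) (Real.exp_pos t).le)]

/-- The midpoint inequality for the convex function `u ↦ 1 / (t + log u)`. -/
lemma one_div_add_log_midpoint_le {t a : ℝ} (ha : 1 < Real.exp t * a) :
    1 / (t + Real.log (a + 1 / 2)) ≤ ∫ u in a..(a + 1), 1 / (t + Real.log u) := by
  have ha0 : 0 < a := pos_of_mul_pos_right (zero_lt_one.trans ha) (Real.exp_pos t).le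
  set m := a + 1 / 2 with hm
  have hm0 : 0 < m := by linarith
  set y := t + Real.log m with hy
  have hy0 : 0 < y := add_log_pos (one_lt_exp_mul_of_le ha (by linarith))
  -- The tangent at the midpoint `m` integrates to its value there; it remains to show that the
  -- graph lies above it.
  have hlin : ∫ u in a..(a + 1), (1 / y - (u - m) * (1 / (m * y ^ 2))) = 1 / y := by
    rw [intervalIntegral.integral_sub (by simp) (Continuous.intervalIntegrable (by fun_prop) _ _),
      intervalIntegral.integral_mul_const, intervalIntegral.integral_sub (by simp) (by simp)]
    simp only [intervalIntegral.integral_const, integral_id, smul_eq_mul]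
    rw [hm]
    ring
  rw [← hlin]
  refine intervalIntegral.integral_mono_on (by linarith)
    (Continuous.intervalIntegrable (by fun_prop) _ _)
    (intervalIntegrable_one_div_add_log ha (by linarith)) fun u hu => ?_
  have hu0 : 0 < u := ha0.trans_le hu.1
  set z := t + Real.log u with hz
  have hz0 : 0 < z := add_log_pos (one_lt_exp_mul_of_le ha hu.1)
  have h1 : z - y ≤ (u - m) / m := by
    have : Real.log (u / m) ≤ u / m - 1 := Real.log_le_sub_one_of_pos (by positivity)
    rw [Real.log_div hu0.ne' hm0.ne'] at this
    rw [sub_div, div_self hm0.ne']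
    linarith
  -- Tangent line of the convex function `1/z` at `y`; with `h1`, concavity of `log`, it yields the
  -- tangent in `u`.
  have h2 : 1 / y - (z - y) / y ^ 2 ≤ 1 / z := by
    rw [div_sub_div _ _ hy0.ne' (by positivity), div_le_div_iff₀ (by positivity) hz0]
    nlinarith [mul_nonneg hy0.le (sq_nonneg (z - y))]
  refine le_trans ?_ h2
  have h3 : (z - y) / y ^ 2 ≤ (u - m) / m / y ^ 2 := by gcongr
  have h4 : (u - m) / m / y ^ 2 = (u - m) * (1 / (m * y ^ 2)) := by field_simp
  linarith

lemma integral_one_div_add_log_le {t a : ℝ} (ha : 1 < Real.exp t * a) :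
    ∫ u in a..(a + 1), 1 / (t + Real.log u) ≤ 1 / (t + Real.log a) := by
  have ha0 : 0 < a := pos_of_mul_pos_right (zero_lt_one.trans ha) (Real.exp_pos t).le
  have := intervalIntegral.integral_mono_on (show a ≤ a + 1 by linarith)
    (intervalIntegrable_one_div_add_log ha (by linarith))
    (intervalIntegrable_const (c := 1 / (t + Real.log a))) fun u hu =>
      one_div_le_one_div_of_le (add_log_pos ha)
        (add_le_add_right (Real.log_le_log ha0 hu.1) t)
  simpa using this

lemma harmonicSum_succ (t r : ℝ) {n : ℕ} (hn : 1 ≤ n) :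
    harmonicSum t r (n + 1) =
      harmonicSum t r n + if r ≤ n then 1 / shiftedHarmonic t n else 0 := by
  unfold harmonicSum
  rw [Finset.sum_filter, Finset.sum_filter, Finset.sum_Ico_succ_top hn]

lemma one_le_of_one_lt_exp_mul {t : ℝ} {n : ℕ} (h : 1 < Real.exp t * n) : 1 ≤ n := by
  rcases Nat.eq_zero_or_pos n with rfl | h0
  · norm_num at h
  · exact h0

lemma betaSeq_succ_sub (t r : ℝ) {n : ℕ} (h : 1 < Real.exp t * n) :
    betaSeq t r (n + 1) - betaSeq t r n = (∫ u in (n : ℝ)..(n + 1), 1 / (t + Real.log u)) -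
      if r ≤ n then 1 / shiftedHarmonic t n else 0 := by
  unfold betaSeq
  rw [harmonicSum_succ t r (one_le_of_one_lt_exp_mul h), ← li_exp_mul_sub h (by linarith)]
  push_cast
  ring

lemma betaSeq_lt_succ (t r : ℝ) {n : ℕ} (h : 1 < Real.exp t * n) :
    betaSeq t r n < betaSeq t r (n + 1) := by
  rw [← sub_pos, betaSeq_succ_sub t r h]
  have hm : 1 < Real.exp t * (n + 1 / 2) := one_lt_exp_mul_of_le h (by linarith)
  have h1 := one_div_add_log_midpoint_le h
  have h2 : 0 < 1 / (t + Real.log (n + 1 / 2)) := one_div_pos.2 (add_log_pos hm)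
  split_ifs
  · have h3 : 1 / shiftedHarmonic t n < 1 / (t + Real.log (n + 1 / 2)) := by
      refine one_div_lt_one_div_of_lt (add_log_pos hm) ?_
      have := log_add_half_lt_harmonic_sub n
      unfold shiftedHarmonic
      linarith
    linarith
  · linarith

/-- Telescoping upper bound: the integral is at most `1/(t + log n)` and the subtracted term at
least `1/(t + log (n + 1))`. -/
lemma betaSeq_succ_le (t r : ℝ) {n : ℕ} (h : 1 < Real.exp t * n) (hr : r ≤ n) :
    betaSeq t r (n + 1) + 1 / (t + Real.log (n + 1 : ℕ)) ≤
      betaSeq t r n + 1 / (t + Real.log n) := by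
  have h0 := betaSeq_succ_sub t r h
  rw [if_pos hr] at h0
  have h1 := integral_one_div_add_log_le h
  have h2 : 1 / (t + Real.log (n + 1 : ℕ)) ≤ 1 / shiftedHarmonic t n := by
    refine one_div_le_one_div_of_le ((add_log_pos h).trans
      (add_log_lt_shiftedHarmonic t (one_le_of_one_lt_exp_mul h))) ?_
    have := harmonic_sub_lt_log_add_one n
    unfold shiftedHarmonic
    push_cast
    linarith
  linarith

lemma betaSeq_le_of_le (t r : ℝ) {m n : ℕ} (h : 1 < Real.exp t * m) (hmn : m ≤ n) :
    betaSeq t r m ≤ betaSeq t r n := by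
  induction n, hmn using Nat.le_induction with
  | base => exact le_rfl
  | succ n hn ih =>
    exact ih.trans (betaSeq_lt_succ t r (one_lt_exp_mul_of_le h (by exact_mod_cast hn))).le

lemma betaSeq_add_le (t r : ℝ) {m n : ℕ} (h : 1 < Real.exp t * m) (hr : r ≤ m) (hmn : m ≤ n) :
    betaSeq t r n + 1 / (t + Real.log n) ≤ betaSeq t r m + 1 / (t + Real.log m) := by
  induction n, hmn using Nat.le_induction with
  | base => exact le_rfl
  | succ n hn ih =>
    have hmn : (m : ℝ) ≤ n := by exact_mod_cast hn
    exact (betaSeq_succ_le t r (one_lt_exp_mul_of_le h hmn) (hr.trans hmn)).trans ih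

lemma tendsto_betaSeq (t r : ℝ) : Tendsto (betaSeq t r) atTop (𝓝 (beta t r)) := by
  -- Beyond `N` both monotonicity statements apply, so no condition relating `r` and `t` is needed
  -- for convergence.
  obtain ⟨N, hN⟩ := exists_nat_gt (max r (Real.exp (-t)))
  have hr : r ≤ N := (le_max_left _ _).trans hN.le
  have h1 : 1 < Real.exp t * N := by
    have := mul_lt_mul_of_pos_left ((le_max_right _ _).trans_lt hN) (Real.exp_pos t)
    rwa [← Real.exp_add, add_neg_cancel, Real.exp_zero] at this
  have hmono : Monotone fun k : ℕ => betaSeq t r (k + N) := by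
    refine monotone_nat_of_le_succ fun k => ?_
    refine betaSeq_le_of_le t r (one_lt_exp_mul_of_le h1 ?_) (by omega)
    exact_mod_cast (by omega : N ≤ k + N)
  have hbdd : BddAbove (range fun k : ℕ => betaSeq t r (k + N)) := by
    refine ⟨betaSeq t r N + 1 / (t + Real.log N), ?_⟩
    rintro _ ⟨k, rfl⟩
    have hk : N ≤ k + N := by omega
    have := betaSeq_add_le t r h1 hr hk
    have hpos : 0 < 1 / (t + Real.log (k + N : ℕ)) :=
      one_div_pos.2 (add_log_pos (one_lt_exp_mul_of_le h1 (by exact_mod_cast hk)))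
    simp only
    linarith
  exact tendsto_nhds_limUnder
    ⟨_, (tendsto_add_atTop_iff_nat N).1 (tendsto_atTop_ciSup hmono hbdd)⟩

lemma betaSeq_lt_beta (t r : ℝ) {n : ℕ} (h : 1 < Real.exp t * n) :
    betaSeq t r n < beta t r := by
  refine (betaSeq_lt_succ t r h).trans_le (ge_of_tendsto (tendsto_betaSeq t r) ?_)
  filter_upwards [eventually_ge_atTop (n + 1)] with k hk
  exact betaSeq_le_of_le t r (one_lt_exp_mul_of_le h (by push_cast; linarith)) hk

lemma le_exp_mul {t c x : ℝ} (h : c * Real.exp (-t) ≤ x) : c ≤ Real.exp t * x := by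
  have := mul_le_mul_of_nonneg_left h (Real.exp_pos t).le
  rwa [mul_left_comm, ← Real.exp_add, add_neg_cancel, Real.exp_zero, mul_one] at this

/-- For `n ≤ ⌈r⌉` the sum is empty and `β_n = li (e^t n)/e^t ≥ 0`; beyond `⌈r⌉` the sequence
increases. -/
lemma betaSeq_nonneg {t r : ℝ} (hr : soldner * Real.exp (-t) ≤ (⌈r⌉ : ℝ)) {n : ℕ}
    (hn : soldner * Real.exp (-t) ≤ n) : 0 ≤ betaSeq t r n := by
  have key : ∀ m : ℕ, soldner * Real.exp (-t) ≤ m → (m : ℤ) ≤ ⌈r⌉ → 0 ≤ betaSeq t r m := by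
    intro m hm hmr
    have h0 : harmonicSum t r m = 0 := by
      unfold harmonicSum
      rw [Finset.filter_false_of_mem, Finset.sum_empty]
      intro k hk hrk
      have h1 : ⌈r⌉ ≤ (k : ℤ) := Int.ceil_le.2 (by exact_mod_cast hrk)
      have h2 := (Finset.mem_Ico.1 hk).2
      omega
    rw [betaSeq, h0, sub_zero]
    exact div_nonneg (li_nonneg (le_exp_mul hm)) (Real.exp_pos t).le
  rcases le_total (n : ℤ) ⌈r⌉ with h | h
  · exact key n hn h
  · have hpos : (0 : ℝ) < ⌈r⌉ :=
      (mul_pos (zero_lt_one.trans one_lt_soldner) (Real.exp_pos _)).trans_le hr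
    have hpos' : 0 < ⌈r⌉ := by exact_mod_cast hpos
    obtain ⟨m, hm⟩ := Int.eq_ofNat_of_zero_le hpos'.le
    have hmr : ((m : ℤ) : ℝ) = ⌈r⌉ := by rw [hm]
    have hm' : soldner * Real.exp (-t) ≤ m := by rw [← hmr] at hr; exact_mod_cast hr
    exact (key m hm' hm.ge).trans
      (betaSeq_le_of_le t r (one_lt_soldner.trans_le (le_exp_mul hm')) (by omega))

lemma abs_betaSeq_lt_beta {t r : ℝ} (hr : soldner * Real.exp (-t) ≤ (⌈r⌉ : ℝ)) {n : ℕ}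
    (hn : soldner * Real.exp (-t) ≤ n) : |betaSeq t r n| < beta t r := by
  rw [abs_of_nonneg (betaSeq_nonneg hr hn)]
  exact betaSeq_lt_beta t r (one_lt_soldner.trans_le (le_exp_mul hn))

end HarmonicPrimes

/-! ### From `π - li` to `θ(x) - x` -/

namespace HarmonicPrimes

open MeasureTheory Set

lemma primePi_mono : Monotone primePi := fun _ _ h =>
  Nat.cast_le.2 (Nat.monotone_primeCounting (Nat.floor_mono h))

lemma primePi_nonneg (x : ℝ) : 0 ≤ primePi x := Nat.cast_nonneg _

lemma li_two_nonneg : 0 ≤ li 2 := by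
  rw [li_eq one_lt_two, show (2 : ℝ) - 1 = 1 by norm_num, Real.log_one, zero_add]
  exact (integral_liRegular_mem_Icc zero_le_two).1

/-- The error bound with `x ^ a * log x` gives one with a larger power, for all `x ≥ 2`. -/
lemma exists_abs_primePi_sub_li_le {M C a m : ℝ} (hM : 0 < M) (ham : a < m) (hm : 0 ≤ m)
    (h : ∀ x : ℝ, C ≤ x → |primePi x - li x| ≤ M * x ^ a * Real.log x) :
    ∃ K : ℝ, 0 ≤ K ∧ ∀ x : ℝ, 2 ≤ x → |primePi x - li x| ≤ K * x ^ m := by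
  set D := max C 2
  have hδ : 0 < m - a := sub_pos.2 ham
  have hD : 0 ≤ primePi D + li D := by
    refine add_nonneg (primePi_nonneg _) (li_two_nonneg.trans ?_)
    exact li_le_li one_lt_two (le_max_right _ _)
  refine ⟨M / (m - a) + (primePi D + li D), by positivity, fun x hx => ?_⟩
  have hx0 : 0 < x := by linarith
  have hxm : 0 < x ^ m := Real.rpow_pos_of_pos hx0 m
  rcases le_total D x with hDx | hxD
  · refine (h x ((le_max_left _ _).trans hDx)).trans ?_
    have hlog := Real.log_le_rpow_div hx0.le hδ
    calc M * x ^ a * Real.log x ≤ M * x ^ a * (x ^ (m - a) / (m - a)) := by gcongr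
      _ = M / (m - a) * x ^ m := by
        rw [Real.rpow_sub hx0]
        have := (Real.rpow_pos_of_pos hx0 a).ne'
        field_simp
      _ ≤ _ := by
        rw [add_mul]
        exact le_add_of_nonneg_right (mul_nonneg hD hxm.le)
  · have h1 : li 2 ≤ li x := li_le_li one_lt_two hx
    have h2 : li x ≤ li D := li_le_li (one_lt_two.trans_le hx) hxD
    have h3 := primePi_mono hxD
    have h4 := primePi_nonneg x
    have h5 : (1 : ℝ) ≤ x ^ m := Real.one_le_rpow (by linarith) hm
    have h6 := li_two_nonneg
    calc |primePi x - li x| ≤ primePi D + li D := by rw [abs_le]; constructor <;> linarith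
      _ ≤ (primePi D + li D) * x ^ m := le_mul_of_one_le_right hD h5
      _ ≤ _ := by
        rw [add_mul]
        have : 0 ≤ M / (m - a) * x ^ m := by positivity
        linarith

lemma integral_li_div {x : ℝ} (hx : 2 ≤ x) :
    IntervalIntegrable (fun t => li t / t) volume 2 x ∧
    ∫ t in (2 : ℝ)..x, li t / t = li x * Real.log x - x - (li 2 * Real.log 2 - 2) := by
  have hint : IntervalIntegrable (fun t => li t / t) volume 2 x := by
    refine ContinuousOn.intervalIntegrable fun u hu => ContinuousAt.continuousWithinAt ?_
    rw [uIcc_of_le hx] at hu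
    have h1 : 1 < u := one_lt_two.trans_le hu.1
    exact (hasDerivAt_li h1).continuousAt.div continuousAt_id (by positivity)
  refine ⟨hint, ?_⟩
  refine intervalIntegral.integral_eq_sub_of_hasDerivAt
    (f := fun t => li t * Real.log t - t) (fun u hu => ?_) hint
  rw [uIcc_of_le hx] at hu
  have h1 : 1 < u := one_lt_two.trans_le hu.1
  have h2 : Real.log u ≠ 0 := (Real.log_pos h1).ne'
  have := ((hasDerivAt_li h1).mul (Real.hasDerivAt_log (by positivity))).sub (hasDerivAt_id u)
  rw [one_div_mul_cancel h2, ← div_eq_mul_inv, add_sub_cancel_left] at this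
  exact this

/-- Partial summation for `θ` and integration by parts for `li` have the same shape; subtracting
them leaves `π - li` and a constant from the endpoint 2. -/
lemma theta_sub_self_eq {x : ℝ} (hx : 2 ≤ x) :
    Chebyshev.theta x - x = (primePi x - li x) * Real.log x -
      (∫ t in (2 : ℝ)..x, (primePi t - li t) / t) + (li 2 * Real.log 2 - 2) := by
  obtain ⟨hli, hval⟩ := integral_li_div hx
  have hpi : IntervalIntegrable (fun t => primePi t / t) volume 2 x := by
    simp_rw [div_eq_mul_inv]
    refine (primePi_mono.intervalIntegrable).mul_continuousOn fun u hu => ?_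
    rw [uIcc_of_le hx] at hu
    have : u ≠ 0 := by linarith [hu.1]
    exact (continuousAt_inv₀ this).continuousWithinAt
  have hsplit : ∫ t in (2 : ℝ)..x, (primePi t - li t) / t =
      (∫ t in (2 : ℝ)..x, primePi t / t) - ∫ t in (2 : ℝ)..x, li t / t := by
    rw [← intervalIntegral.integral_sub hpi hli]
    simp_rw [sub_div]
  rw [hsplit, hval, Chebyshev.theta_eq_primeCounting_mul_log_sub_integral hx]
  unfold primePi
  ring

lemma theta_sub_self_isBigO {M C a b : ℝ} (hM : 0 < M) (ha : 0 < a) (hab : a < b)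
    (h : ∀ x : ℝ, C ≤ x → |primePi x - li x| ≤ M * x ^ a * Real.log x) :
    (fun n : ℕ => Chebyshev.theta n - n) =O[atTop] fun n : ℕ => (n : ℝ) ^ b := by
  -- Two logarithms must be absorbed: the one in the hypothesis costs `m - a`, the factor `log x` in
  -- `theta_sub_self_eq` costs `b - m`.
  set m := (a + b) / 2 with hmdef
  have ham : a < m := by rw [hmdef]; linarith
  have hmb : m < b := by rw [hmdef]; linarith
  have hm0 : 0 < m := ha.trans ham
  have hδ : 0 < b - m := sub_pos.2 hmb
  obtain ⟨K, hK0, hK⟩ := exists_abs_primePi_sub_li_le hM ham hm0.le h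
  refine Asymptotics.IsBigO.of_bound (K / (b - m) + K / m + |li 2 * Real.log 2 - 2|) ?_
  filter_upwards [eventually_ge_atTop 2] with n hn
  have hx : (2 : ℝ) ≤ n := by exact_mod_cast hn
  generalize (n : ℝ) = x at hx
  have hx0 : 0 < x := by linarith
  have hxb : 1 ≤ x ^ b := Real.one_le_rpow (by linarith) (hm0.trans hmb).le
  have hmx : x ^ m ≤ x ^ b := Real.rpow_le_rpow_of_exponent_le (by linarith) hmb.le
  rw [theta_sub_self_eq hx, Real.norm_of_nonneg (by linarith : 0 ≤ x ^ b)]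
  have hint : ‖∫ t in (2 : ℝ)..x, (primePi t - li t) / t‖ ≤ ∫ t in (2 : ℝ)..x, K * t ^ (m - 1) := by
    refine intervalIntegral.norm_integral_le_of_norm_le hx (Eventually.of_forall fun t ht => ?_) ?_
    · have ht0 : 0 < t := by linarith [ht.1]
      rw [norm_div, Real.norm_eq_abs, Real.norm_of_nonneg ht0.le, Real.rpow_sub_one ht0.ne',
        ← mul_div_assoc]
      exact div_le_div_of_nonneg_right (hK t ht.1.le) ht0.le
    · exact (intervalIntegral.intervalIntegrable_rpow' (by linarith)).const_mul K
  have hval : ∫ t in (2 : ℝ)..x, K * t ^ (m - 1) ≤ K / m * x ^ b := by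
    rw [intervalIntegral.integral_const_mul, integral_rpow (Or.inl (by linarith)),
      sub_add_cancel, div_mul_eq_mul_div, ← mul_div_assoc]
    have : 0 < (2 : ℝ) ^ m := Real.rpow_pos_of_pos two_pos m
    gcongr
    linarith
  have hE : ‖(primePi x - li x) * Real.log x‖ ≤ K / (b - m) * x ^ b := by
    have hlog := Real.log_le_rpow_div hx0.le hδ
    rw [norm_mul, Real.norm_eq_abs, Real.norm_of_nonneg (Real.log_nonneg (by linarith))]
    calc |primePi x - li x| * Real.log x ≤ K * x ^ m * (x ^ (b - m) / (b - m)) := by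
          refine mul_le_mul (hK x hx) hlog (Real.log_nonneg (by linarith)) (by positivity)
      _ = K / (b - m) * x ^ b := by
        rw [Real.rpow_sub hx0]
        have := (Real.rpow_pos_of_pos hx0 m).ne'
        field_simp
  calc _ ≤ ‖(primePi x - li x) * Real.log x‖ + ‖∫ t in (2 : ℝ)..x, (primePi t - li t) / t‖ +
        ‖li 2 * Real.log 2 - 2‖ := (norm_add_le _ _).trans (by gcongr; exact norm_sub_le _ _)
    _ ≤ K / (b - m) * x ^ b + K / m * x ^ b + |li 2 * Real.log 2 - 2| * x ^ b := by
        have := le_mul_of_one_le_right (abs_nonneg (li 2 * Real.log 2 - 2)) hxb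
        rw [Real.norm_eq_abs (li 2 * Real.log 2 - 2)]
        linarith
    _ = _ := by ring

end HarmonicPrimes

/-! ### From `θ(n) - n` to a zero-free half-plane -/

namespace HarmonicPrimes

open Set ArithmeticFunction

section Dirichlet

/-- The integral that represents a Dirichlet series through its summatory function. -/
noncomputable def summatoryTransform (c : ℕ → ℂ) (s : ℂ) : ℂ :=
  s * ∫ t in Ioi (1 : ℝ), (∑ k ∈ Finset.Icc 1 ⌊t⌋₊, c k) * (t : ℂ) ^ (-(s + 1))

lemma summatoryTransform_eq_mellin (c : ℕ → ℂ) (s : ℂ) :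
    summatoryTransform c s = s * mellin (fun t : ℝ => ∑ k ∈ Finset.Icc 1 ⌊t⌋₊, c k) (-s) := by
  unfold summatoryTransform mellin
  congr 1
  rw [← MeasureTheory.integral_Ici_eq_integral_Ioi]
  have hsub : Ici (1 : ℝ) ⊆ Ioi 0 := fun t ht => zero_lt_one.trans_le (mem_Ici.1 ht)
  refine Eq.trans ?_ (MeasureTheory.setIntegral_eq_of_subset_of_forall_sdiff_eq_zero
    measurableSet_Ioi hsub ?_).symm
  · refine MeasureTheory.setIntegral_congr_fun measurableSet_Ici fun t _ => ?_
    simp only [smul_eq_mul]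
    rw [mul_comm, neg_add']
  · rintro t ⟨_, ht⟩
    have : ⌊t⌋₊ = 0 := Nat.floor_eq_zero.2 (not_le.1 ht)
    simp [this]

/-- The summatory function vanishes on `(0, 1)`, so the strip of its Mellin transform is limited
only by growth at infinity. -/
lemma differentiableAt_summatoryTransform {c : ℕ → ℂ} {r : ℝ} (hr : 0 ≤ r)
    (hc : (fun n : ℕ => ∑ k ∈ Finset.Icc 1 n, c k) =O[atTop] fun n : ℕ => (n : ℝ) ^ r)
    {s : ℂ} (hs : r < s.re) : DifferentiableAt ℂ (summatoryTransform c) s := by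
  have hloc : MeasureTheory.LocallyIntegrableOn
      (fun t : ℝ => ∑ k ∈ Finset.Icc 1 ⌊t⌋₊, c k) (Ioi 0) := by
    have := locallyIntegrableOn_mul_sum_Icc (m := 1) c le_rfl (g := fun _ : ℝ => (1 : ℂ))
      (MeasureTheory.locallyIntegrableOn_const 1)
    simp only [one_mul] at this
    exact this.mono_set Ioi_subset_Ici_self
  have htop : (fun t : ℝ => ∑ k ∈ Finset.Icc 1 ⌊t⌋₊, c k) =O[atTop] (· ^ (-(-r)) : ℝ → ℝ) := by
    rw [neg_neg]
    exact (hc.comp_tendsto tendsto_nat_floor_atTop).trans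
      (Asymptotics.isEquivalent_nat_floor.isBigO.rpow hr (eventually_ge_atTop 0))
  have hbot : (fun t : ℝ => ∑ k ∈ Finset.Icc 1 ⌊t⌋₊, c k) =O[𝓝[>] 0]
      (· ^ (-((-s).re - 1)) : ℝ → ℝ) := by
    refine Asymptotics.IsBigO.of_bound 1 ?_
    filter_upwards [Ioo_mem_nhdsGT (show (0 : ℝ) < 1 from one_pos)] with t ht
    have : ⌊t⌋₊ = 0 := Nat.floor_eq_zero.2 ht.2
    simp [this]
  have := mellin_differentiableAt_of_isBigO_rpow (s := -s) hloc htop (by simpa using hs) hbot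
    (by linarith)
  have heq : summatoryTransform c = fun s =>
      s * mellin (fun t : ℝ => ∑ k ∈ Finset.Icc 1 ⌊t⌋₊, c k) (-s) :=
    funext (summatoryTransform_eq_mellin c)
  rw [heq]
  exact differentiableAt_id.mul (this.comp s differentiableAt_id.neg)

end Dirichlet

/-- The coefficients `log p - 1` at primes and `-1` elsewhere. -/
noncomputable def primeLogDefect (n : ℕ) : ℂ :=
  (((if n.Prime then Real.log n else 0) - 1 : ℝ) : ℂ)

/-- The von Mangoldt function, restricted to integers that are not prime. -/
noncomputable def nonprimeMangoldt (n : ℕ) : ℝ := if n.Prime then 0 else vonMangoldt n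

lemma nonprimeMangoldt_nonneg (n : ℕ) : 0 ≤ nonprimeMangoldt n := by
  unfold nonprimeMangoldt
  split_ifs
  exacts [le_rfl, vonMangoldt_nonneg]

lemma vonMangoldt_eq_add (n : ℕ) :
    ((vonMangoldt n : ℝ) : ℂ) = primeLogDefect n + 1 + (nonprimeMangoldt n : ℂ) := by
  unfold primeLogDefect nonprimeMangoldt
  split_ifs with h
  · rw [vonMangoldt_apply_prime h]; push_cast; ring
  · push_cast; ring

lemma sum_primeLogDefect (n : ℕ) :
    ∑ k ∈ Finset.Icc 1 n, primeLogDefect k = ((Chebyshev.theta n - n : ℝ) : ℂ) := by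
  unfold primeLogDefect Chebyshev.theta
  rw [← Complex.ofReal_sum, Finset.sum_sub_distrib, Nat.floor_natCast, Finset.sum_filter]
  simp
  rfl

lemma sum_nonprimeMangoldt (n : ℕ) :
    ∑ k ∈ Finset.Icc 1 n, nonprimeMangoldt k = Chebyshev.psi n - Chebyshev.theta n := by
  rw [Chebyshev.psi_sub_theta_eq_sum_not_prime, Nat.floor_natCast, Finset.sum_filter]
  refine Finset.sum_congr rfl fun k _ => ?_
  unfold nonprimeMangoldt
  split_ifs <;> rfl

/-- The partial sums are `ψ - θ = O(√x)`. -/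
lemma LSeriesSummable_nonprimeMangoldt {s : ℂ} (hs : 1 / 2 < s.re) :
    LSeriesSummable (fun n => (nonprimeMangoldt n : ℂ)) s := by
  refine LSeriesSummable_of_sum_norm_bigO_and_nonneg (r := 1 / 2) ?_ nonprimeMangoldt_nonneg
    (by norm_num) hs
  simp_rw [sum_nonprimeMangoldt, ← Real.sqrt_eq_rpow]
  exact Chebyshev.isBigO_psi_sub_theta_sqrt.comp_tendsto tendsto_natCast_atTop_atTop

lemma differentiableAt_LSeries_nonprimeMangoldt {s : ℂ} (hs : 1 / 2 < s.re) :
    DifferentiableAt ℂ (LSeries fun n => (nonprimeMangoldt n : ℂ)) s := by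
  refine (LSeries_hasDerivAt (lt_of_le_of_lt
    (LSeries.abscissaOfAbsConv_le_of_forall_lt_LSeriesSummable (x := 1 / 2) fun y hy =>
      LSeriesSummable_nonprimeMangoldt (by simpa using hy)) ?_)).differentiableAt
  exact_mod_cast hs

/-- The decomposition of `-ζ'/ζ - ζ` into parts with a larger domain of analyticity. -/
noncomputable def zetaLogDerivPart (s : ℂ) : ℂ :=
  summatoryTransform primeLogDefect s + LSeries (fun n => (nonprimeMangoldt n : ℂ)) s

lemma sum_primeLogDefect_isBigO {b : ℝ}
    (h : (fun n : ℕ => Chebyshev.theta n - n) =O[atTop] fun n : ℕ => (n : ℝ) ^ b) :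
    (fun n : ℕ => ∑ k ∈ Finset.Icc 1 n, primeLogDefect k) =O[atTop] fun n : ℕ => (n : ℝ) ^ b := by
  simp_rw [sum_primeLogDefect]
  exact (Complex.isBigO_ofReal_left).2 h

/-- The form without division by `ζ` is analytic at possible zeros too, so it can be continued. -/
lemma deriv_riemannZeta_eq_of_one_lt_re {b : ℝ} (hb0 : 0 ≤ b) (hb1 : b ≤ 1)
    (h : (fun n : ℕ => Chebyshev.theta n - n) =O[atTop] fun n : ℕ => (n : ℝ) ^ b)
    {s : ℂ} (hs : 1 < s.re) :
    deriv riemannZeta s = riemannZeta s * -(riemannZeta s + zetaLogDerivPart s) := by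
  have hq := LSeriesSummable_nonprimeMangoldt (show 1 / 2 < s.re by linarith)
  have h1 : LSeriesSummable 1 s := LSeriesSummable_one_iff.2 hs
  have hΛ := LSeriesSummable_vonMangoldt hs
  have hc : LSeriesSummable primeLogDefect s := by
    have := (hΛ.sub hq).sub h1
    convert this using 1
    funext n
    simp only [Pi.sub_apply, Pi.one_apply, vonMangoldt_eq_add]
    ring
  have hsum : LSeries (fun n => ((vonMangoldt n : ℝ) : ℂ)) s =
      LSeries primeLogDefect s + LSeries 1 s + LSeries (fun n => (nonprimeMangoldt n : ℂ)) s := by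
    rw [← LSeries_add hc h1, ← LSeries_add (hc.add h1) hq]
    congr 1
    funext n
    simp [vonMangoldt_eq_add]
  have hA : LSeries primeLogDefect s = summatoryTransform primeLogDefect s :=
    LSeries_eq_mul_integral _ hb0 (hb1.trans_lt hs) hc (sum_primeLogDefect_isBigO h)
  have hz := riemannZeta_ne_zero_of_one_lt_re hs
  have hlog := LSeries_vonMangoldt_eq_deriv_riemannZeta_div hs
  rw [hsum, hA, LSeries_one_eq_riemannZeta hs, eq_div_iff hz] at hlog
  unfold zetaLogDerivPart
  linear_combination hlog

/-- A half-plane `b < re s`, cut along the ray `re s = 1`, `im s ≤ 0`. -/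
def cutHalfPlane (b : ℝ) : Set ℂ := {s | b < s.re ∧ (s.re < 1 ∨ 0 < s.im ∨ 1 < s.re)}

lemma isOpen_cutHalfPlane (b : ℝ) : IsOpen (cutHalfPlane b) :=
  (isOpen_lt continuous_const Complex.continuous_re).inter
    ((isOpen_lt Complex.continuous_re continuous_const).union
      ((isOpen_lt continuous_const Complex.continuous_im).union
        (isOpen_lt continuous_const Complex.continuous_re)))

/-- The cut removes the pole at 1 and leaves a chain of three overlapping convex sets, which suits
the identity theorem. -/
lemma isPreconnected_cutHalfPlane {b : ℝ} (hb : b < 1) : IsPreconnected (cutHalfPlane b) := by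
  have hset : cutHalfPlane b = ({s : ℂ | b < s.re} ∩ {s | s.re < 1}) ∪
      (({s : ℂ | b < s.re} ∩ {s | 0 < s.im}) ∪ {s | 1 < s.re}) := by
    ext s
    simp only [cutHalfPlane, mem_ofPred_eq, mem_union, mem_inter_iff]
    constructor
    · tauto
    · rintro (h | h | h)
      · tauto
      · tauto
      · exact ⟨hb.trans h, Or.inr (Or.inr h)⟩
  rw [hset]
  have c1 := ((convex_halfSpace_re_gt b).inter (convex_halfSpace_re_lt 1)).isPreconnected
  have c2 := ((convex_halfSpace_re_gt b).inter (convex_halfSpace_im_gt 0)).isPreconnected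
  have c3 := (convex_halfSpace_re_gt 1).isPreconnected
  refine c1.union ⟨(b + 1) / 2, 1⟩ ?_ ?_ (c2.union ⟨2, 1⟩ ?_ ?_ c3)
  · exact ⟨show b < (b + 1) / 2 by linarith, show (b + 1) / 2 < 1 by linarith⟩
  · exact Or.inl ⟨show b < (b + 1) / 2 by linarith, show (0 : ℝ) < 1 by norm_num⟩
  · exact ⟨show b < 2 by linarith, show (0 : ℝ) < 1 by norm_num⟩
  · exact show (1 : ℝ) < 2 by norm_num

lemma ne_one_of_mem_cutHalfPlane {b : ℝ} {s : ℂ} (hs : s ∈ cutHalfPlane b) : s ≠ 1 := by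
  rintro rfl
  rcases hs.2 with h | h | h <;> norm_num at h

lemma deriv_riemannZeta_eq {b : ℝ} (hb0 : 0 ≤ b) (hb1 : b < 1)
    (h : (fun n : ℕ => Chebyshev.theta n - n) =O[atTop] fun n : ℕ => (n : ℝ) ^ b)
    {s : ℂ} (hs : s ∈ cutHalfPlane (max b (1 / 2))) :
    deriv riemannZeta s = riemannZeta s * -(riemannZeta s + zetaLogDerivPart s) := by
  set U := cutHalfPlane (max b (1 / 2)) with hU
  have hopen : IsOpen U := isOpen_cutHalfPlane _
  have hζ : DifferentiableOn ℂ riemannZeta U := fun z hz =>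
    (differentiableAt_riemannZeta (ne_one_of_mem_cutHalfPlane hz)).differentiableWithinAt
  have hP : DifferentiableOn ℂ zetaLogDerivPart U := fun z hz =>
    ((differentiableAt_summatoryTransform hb0 (sum_primeLogDefect_isBigO h)
      ((le_max_left _ _).trans_lt hz.1)).add
      (differentiableAt_LSeries_nonprimeMangoldt
        ((le_max_right _ _).trans_lt hz.1))).differentiableWithinAt
  refine (hζ.analyticOnNhd hopen).deriv.eqOn_of_preconnected_of_eventuallyEq
    ((hζ.mul (hζ.add hP).neg).analyticOnNhd hopen)
    (isPreconnected_cutHalfPlane (max_lt hb1 (by norm_num))) (z₀ := 2) ?_ ?_ hs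
  · refine ⟨max_lt ?_ ?_, Or.inr (Or.inr ?_)⟩ <;> norm_num
    linarith
  · filter_upwards [(isOpen_lt continuous_const Complex.continuous_re).mem_nhds
      (show (1 : ℝ) < (2 : ℂ).re by norm_num)] with z hz
    exact deriv_riemannZeta_eq_of_one_lt_re hb0 hb1.le h hz

lemma not_eventually_riemannZeta_eq_zero {s : ℂ} (hs : s ≠ 1) :
    ¬ ∀ᶠ z in 𝓝 s, riemannZeta z = 0 := fun h =>
  riemannZeta_ne_zero_of_one_le_re (s := 2) (by norm_num)
    (analyticOn_riemannZeta.eqOn_zero_of_preconnected_of_eventuallyEq_zero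
      (isConnected_compl_singleton_of_one_lt_rank (by simp) 1).isPreconnected hs h
      (show (2 : ℂ) ∈ ({1}ᶜ : Set ℂ) by norm_num))

/-- A solution of `f' = f * g` with `g` analytic cannot vanish at a point unless it vanishes
nearby. -/
lemma ne_zero_of_deriv_eq_mul {f g : ℂ → ℂ} {s : ℂ} (hf : AnalyticAt ℂ f s)
    (hg : AnalyticAt ℂ g s) (hne : ¬ ∀ᶠ z in 𝓝 s, f z = 0)
    (h : ∀ᶠ z in 𝓝 s, deriv f z = f z * g z) : f s ≠ 0 := by
  intro h0
  have h1 := hf.analyticOrderAt_deriv_add_one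
  simp only [h0, sub_zero] at h1
  have h2 : analyticOrderAt (deriv f) s = analyticOrderAt f s + analyticOrderAt g s := by
    rw [← analyticOrderAt_mul hf hg]
    exact analyticOrderAt_congr h
  have h3 : analyticOrderAt f s ≠ ⊤ := fun h => hne (analyticOrderAt_eq_top.1 h)
  -- At a zero `f'` has order one less than `f`, but `f' = f g` makes its order at least that of
  -- `f`.
  have h4 : analyticOrderAt f s + 1 ≤ analyticOrderAt f s := by
    conv_rhs => rw [← h1, h2]
    gcongr
    exact le_self_add
  exact absurd h4 (not_le.2 ((ENat.lt_add_one_iff h3).2 le_rfl))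

lemma riemannZeta_ne_zero_of_theta_isBigO {b : ℝ} (hb0 : 0 ≤ b) (hb1 : b < 1)
    (h : (fun n : ℕ => Chebyshev.theta n - n) =O[atTop] fun n : ℕ => (n : ℝ) ^ b)
    {s : ℂ} (hs : max b (1 / 2) < s.re) : riemannZeta s ≠ 0 := by
  rcases le_or_gt 1 s.re with h1 | h1
  · exact riemannZeta_ne_zero_of_one_le_re h1
  have hmem : s ∈ cutHalfPlane (max b (1 / 2)) := ⟨hs, Or.inl h1⟩
  have hopen := (isOpen_cutHalfPlane (max b (1 / 2))).mem_nhds hmem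
  have hne := ne_one_of_mem_cutHalfPlane hmem
  have hζ := analyticOn_riemannZeta s hne
  have hP : DifferentiableOn ℂ zetaLogDerivPart (cutHalfPlane (max b (1 / 2))) := fun z hz =>
    ((differentiableAt_summatoryTransform hb0 (sum_primeLogDefect_isBigO h)
      ((le_max_left _ _).trans_lt hz.1)).add
      (differentiableAt_LSeries_nonprimeMangoldt
        ((le_max_right _ _).trans_lt hz.1))).differentiableWithinAt
  refine ne_zero_of_deriv_eq_mul hζ (hζ.add (hP.analyticAt hopen)).neg
    (not_eventually_riemannZeta_eq_zero hne) ?_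
  filter_upwards [hopen] with z hz
  exact deriv_riemannZeta_eq hb0 hb1 h hz

/-! ### Exclusion of exponents below `1/2` -/

/-- The logarithmic derivative of an analytic function is bounded below to the right of a point. -/
lemma exists_re_logDeriv_ge {f : ℂ → ℂ} {x : ℝ} (hf : AnalyticAt ℂ f x)
    (hne : ¬ ∀ᶠ z in 𝓝 (x : ℂ), f z = 0) :
    ∃ B : ℝ, ∀ᶠ σ : ℝ in 𝓝[>] x, f σ ≠ 0 ∧ B ≤ (logDeriv f σ).re := by
  obtain ⟨m, g, hg, hg0, hfg⟩ := hf.exists_eventuallyEq_pow_smul_nonzero_iff.2 hne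
  have hcont : ContinuousAt (fun z => (logDeriv g z).re) x :=
    Complex.continuous_re.continuousAt.comp (hg.deriv.continuousAt.div hg.continuousAt hg0)
  have hto : Tendsto (fun σ : ℝ => (σ : ℂ)) (𝓝[>] x) (𝓝 (x : ℂ)) :=
    (Complex.continuous_ofReal.tendsto x).mono_left nhdsWithin_le_nhds
  refine ⟨(logDeriv g x).re - 1, ?_⟩
  filter_upwards [hto.eventually hfg.eventually_nhds, hto.eventually
    (hcont.eventually (lt_mem_nhds (sub_one_lt _))), hto.eventually hg.eventually_analyticAt,
    hto.eventually (hg.continuousAt.eventually_ne hg0), self_mem_nhdsWithin] with σ h1 h2 h3 h4 h5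
  have hσ : (0 : ℝ) < σ - x := sub_pos.2 h5
  have hσ' : (σ : ℂ) - x ≠ 0 := by exact_mod_cast hσ.ne'
  have hfσ : f σ = ((σ : ℂ) - x) ^ m * g σ := h1.self_of_nhds
  refine ⟨by rw [hfσ]; exact mul_ne_zero (pow_ne_zero _ hσ') h4, ?_⟩
  have hld : logDeriv f σ = m * (1 / ((σ : ℂ) - x)) + logDeriv g σ := by
    have e1 : logDeriv f σ = logDeriv (fun z => (z - (x : ℂ)) ^ m * g z) σ := by
      rw [logDeriv_apply, logDeriv_apply, EventuallyEq.deriv_eq h1, h1.self_of_nhds]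
      rfl
    rw [e1, logDeriv_mul (f := fun z => (z - (x : ℂ)) ^ m) (g := g) _ (pow_ne_zero _ hσ') h4 (by fun_prop)
      h3.differentiableAt,
      logDeriv_fun_pow (by fun_prop)]
    simp [logDeriv_apply]
  rw [hld, Complex.add_re]
  -- A zero of order `m` contributes `m/(σ - x)`, which is nonnegative to the right of `x`; hence `ζ
  -- (1/2) ≠ 0` is not needed later.
  have : 0 ≤ ((m : ℂ) * (1 / ((σ : ℂ) - x))).re := by
    have e : (m : ℂ) * (1 / ((σ : ℂ) - x)) = ((m * (1 / (σ - x)) : ℝ) : ℂ) := by push_cast; rfl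
    rw [e, Complex.ofReal_re]
    positivity
  linarith

lemma sum_range_nonprimeMangoldt_le {σ : ℝ} (hσ : 1 / 2 < σ) (N : ℕ) :
    ∑ n ∈ Finset.range N, nonprimeMangoldt n * (n : ℝ) ^ (-σ) ≤
      (LSeries (fun n => (nonprimeMangoldt n : ℂ)) σ).re := by
  have h0 : nonprimeMangoldt 0 = 0 := by simp [nonprimeMangoldt]
  have hterm : ∀ n : ℕ, LSeries.term (fun n => (nonprimeMangoldt n : ℂ)) σ n =
      ((nonprimeMangoldt n * (n : ℝ) ^ (-σ) : ℝ) : ℂ) := fun n => by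
    rw [LSeries.term_def₀ (by simp [h0])]
    push_cast
    rw [Complex.ofReal_cpow (Nat.cast_nonneg n)]
    push_cast
    rfl
  have hs := (LSeriesSummable_nonprimeMangoldt (s := σ) (by simpa using hσ)).LSeriesHasSum
  rw [LSeriesHasSum, funext hterm] at hs
  have hre := Complex.hasSum_re hs
  simp only [Complex.ofReal_re] at hre
  exact sum_le_hasSum (Finset.range N) (fun n _ =>
    mul_nonneg (nonprimeMangoldt_nonneg n) (Real.rpow_nonneg (Nat.cast_nonneg n) _)) hre

/-- The squares `p^2` alone contribute `log p / p ≥ log 2 / p`, and `∑ 1/p` diverges. -/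
lemma not_summable_nonprimeMangoldt :
    ¬ Summable fun n : ℕ => nonprimeMangoldt n * (n : ℝ) ^ (-(1 / 2) : ℝ) := by
  intro hs
  have hsq : Function.Injective fun n : ℕ => n ^ 2 := Nat.pow_left_injective two_ne_zero
  have h2 := (hs.comp_injective hsq).mul_left (1 / Real.log 2)
  have hlog2 : 0 < Real.log 2 := Real.log_pos one_lt_two
  refine not_summable_one_div_on_primes (h2.of_nonneg_of_le
    (fun n => indicator_nonneg (fun k _ => by positivity) n) fun n => ?_)
  by_cases hp : n.Prime
  · rw [indicator_of_mem (by exact hp)]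
    have hnp : ¬ (n ^ 2).Prime := Nat.Prime.not_prime_pow le_rfl
    have hn2 : (2 : ℝ) ≤ n := by exact_mod_cast hp.two_le
    have hrpow : ((n ^ 2 : ℕ) : ℝ) ^ (-(1 / 2) : ℝ) = 1 / n := by
      push_cast
      rw [Real.rpow_neg (by positivity), ← Real.sqrt_eq_rpow, Real.sqrt_sq (by positivity), one_div]
    simp only [Function.comp, nonprimeMangoldt, if_neg hnp, hrpow]
    rw [vonMangoldt_apply_pow two_ne_zero, vonMangoldt_apply_prime hp, ← mul_assoc,
      one_div_mul_eq_div]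
    refine le_mul_of_one_le_left (by positivity) ((one_le_div hlog2).2 ?_)
    exact Real.log_le_log two_pos hn2
  · rw [indicator_of_notMem (by exact hp)]
    exact mul_nonneg (by positivity)
      (mul_nonneg (nonprimeMangoldt_nonneg _) (Real.rpow_nonneg (Nat.cast_nonneg _) _))

/-- For real `σ → 1/2+` one has `Q = -ζ'/ζ - ζ - A` with `ζ` and `A` continuous at `1/2` and `ζ'/ζ`
bounded below, so `Q` is bounded above. Its terms are nonnegative, so the series would converge at
`1/2`. -/
lemma not_theta_isBigO_of_lt_half {b : ℝ} (hb0 : 0 ≤ b) (hb : b < 1 / 2) :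
    ¬ (fun n : ℕ => Chebyshev.theta n - n) =O[atTop] fun n : ℕ => (n : ℝ) ^ b := by
  intro h
  have hne : (((1 / 2 : ℝ) : ℂ)) ≠ 1 := by
    intro h
    have := congrArg Complex.re h
    norm_num at this
  obtain ⟨B, hB⟩ := exists_re_logDeriv_ge (analyticOn_riemannZeta _ hne)
    (not_eventually_riemannZeta_eq_zero hne)
  have hA : ContinuousAt (fun z => (riemannZeta z + summatoryTransform primeLogDefect z).re)
      ((1 / 2 : ℝ) : ℂ) :=
    Complex.continuous_re.continuousAt.comp ((differentiableAt_riemannZeta hne).continuousAt.add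
      (differentiableAt_summatoryTransform hb0 (sum_primeLogDefect_isBigO h)
        (by simpa using hb)).continuousAt)
  set A := (riemannZeta ((1 / 2 : ℝ) : ℂ) + summatoryTransform primeLogDefect ((1 / 2 : ℝ) : ℂ)).re
  have hto : Tendsto (fun σ : ℝ => (σ : ℂ)) (𝓝[>] (1 / 2)) (𝓝 ((1 / 2 : ℝ) : ℂ)) :=
    (Complex.continuous_ofReal.tendsto _).mono_left nhdsWithin_le_nhds
  have hQ : ∀ᶠ σ : ℝ in 𝓝[>] (1 / 2),
      (LSeries (fun n => (nonprimeMangoldt n : ℂ)) σ).re ≤ 1 - A - B := by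
    filter_upwards [hB, hto.eventually (hA.eventually (lt_mem_nhds (sub_one_lt A))),
      Ioo_mem_nhdsGT (show (1 / 2 : ℝ) < 1 by norm_num)] with σ h1 h2 h3
    have hmem : (σ : ℂ) ∈ cutHalfPlane (max b (1 / 2)) :=
      ⟨max_lt (hb.trans h3.1) h3.1, Or.inl h3.2⟩
    have hd := deriv_riemannZeta_eq hb0 (by linarith) h hmem
    have h4 := h1.2
    rw [logDeriv_apply, hd, mul_div_cancel_left₀ _ h1.1] at h4
    unfold zetaLogDerivPart at h4
    simp only [Complex.neg_re, Complex.add_re] at h4 h2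
    linarith
  refine not_summable_nonprimeMangoldt (summable_of_sum_range_le (c := 1 - A - B) (fun n =>
    mul_nonneg (nonprimeMangoldt_nonneg n) (Real.rpow_nonneg (Nat.cast_nonneg n) _)) fun N => ?_)
  have hcont : ContinuousAt (fun σ : ℝ =>
      ∑ n ∈ Finset.range N, nonprimeMangoldt n * (n : ℝ) ^ (-σ)) (1 / 2) := by
    refine tendsto_finsetSum _ fun n _ => ContinuousAt.mul continuousAt_const ?_
    exact (Real.continuousAt_const_rpow' (by norm_num)).comp continuousAt_neg
  refine le_of_tendsto (hcont.mono_left (nhdsWithin_le_nhds (s := Ioi (1 / 2)))) ?_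
  filter_upwards [hQ, self_mem_nhdsWithin] with σ h1 h2
  exact (sum_range_nonprimeMangoldt_le h2 N).trans h1

theorem half_le_and_zetaZero_re_le {a : ℝ} (ha : 0 ≤ a)
    (h : ∀ b : ℝ, a < b →
      (fun n : ℕ => Chebyshev.theta n - n) =O[atTop] fun n : ℕ => (n : ℝ) ^ b) :
    1 / 2 ≤ a ∧ ∀ s : ℂ, riemannZeta s = 0 → s.re ≤ a := by
  -- Needed first: the zero-free region reaches only to `max b (1 / 2)`.
  have ha2 : 1 / 2 ≤ a := by
    by_contra! hlt
    exact not_theta_isBigO_of_lt_half (b := (a + 1 / 2) / 2) (by linarith) (by linarith)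
      (h _ (by linarith))
  refine ⟨ha2, fun s hs => ?_⟩
  by_contra! hlt
  have h1 : s.re < 1 := by
    by_contra! h1
    exact riemannZeta_ne_zero_of_one_le_re h1 hs
  refine riemannZeta_ne_zero_of_theta_isBigO (b := (a + s.re) / 2) (by linarith) (by linarith)
    (h _ (by linarith)) (max_lt ?_ ?_) hs <;> linarith

end HarmonicPrimes

/-! ### The four bounds and the converse -/

namespace HarmonicPrimes

open Set

lemma zetaZeroSup_le {a : ℝ} (h : ∀ s : ℂ, riemannZeta s = 0 → s.re ≤ a) : zetaZeroSup ≤ a := by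
  refine csSup_le ⟨_, -2 * ((0 : ℕ) + 1), riemannZeta_neg_two_mul_nat_add_one 0, rfl⟩ ?_
  rintro _ ⟨s, hs, rfl⟩
  exact h s hs

/-- A bound `O(x ^ α log x)` for `π - li` forces `α ≥ 1 / 2` and bounds the zeros of `ζ`. -/
theorem half_le_and_zetaZeroSup_le {M C α : ℝ} (hM : 0 < M)
    (h : ∀ x : ℝ, C ≤ x → |primePi x - li x| ≤ M * x ^ α * Real.log x) :
    1 / 2 ≤ α ∧ zetaZeroSup ≤ α := by
  -- The earlier results need a positive exponent; as `1/4 < 1/2`, the conclusion `1/2 ≤ max α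
  -- (1/4)` shows that the maximum is `α`.
  have ha : 0 < max α (1 / 4) := lt_max_of_lt_right (by norm_num)
  have h' : ∀ x : ℝ, max C 1 ≤ x →
      |primePi x - li x| ≤ M * x ^ max α (1 / 4) * Real.log x := fun x hx => by
    have hx1 : 1 ≤ x := (le_max_right _ _).trans hx
    refine (h x ((le_max_left _ _).trans hx)).trans ?_
    have := Real.log_nonneg hx1
    gcongr
    exact le_max_left _ _
  obtain ⟨h1, h2⟩ := half_le_and_zetaZero_re_le ha.le
    fun b hb => theta_sub_self_isBigO hM ha hb h'
  have hα : max α (1 / 4) = α := by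
    refine max_eq_left ?_
    by_contra! hlt
    rw [max_eq_right hlt.le] at h1
    norm_num at h1
  rw [hα] at h1 h2
  exact ⟨h1, zetaZeroSup_le h2⟩

lemma li_exp_mul_sub_harmonicSum (t r : ℝ) (n : ℕ) :
    li (Real.exp t * n) - Real.exp t * harmonicSum t r n = Real.exp t * betaSeq t r n := by
  unfold betaSeq
  rw [mul_sub, mul_div_cancel₀ _ (Real.exp_pos t).ne']

lemma exp_mul_rpow (t α : ℝ) {x : ℝ} (hx : 0 ≤ x) :
    (Real.exp t * x) ^ α = Real.exp (α * t) * x ^ α := by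
  rw [Real.mul_rpow (Real.exp_pos t).le hx, ← Real.exp_mul, mul_comm t]

lemma density_bound_iff (M α t lam S L : ℝ) {n : ℕ} (hn : 1 ≤ n) :
    |primeDensity (Real.exp t * n) - 1 / (n : ℝ) * S| <
        M / Real.exp ((1 - α) * t) * (L / (n : ℝ) ^ (1 - α)) + lam / n ↔
      |primePi (Real.exp t * n) - Real.exp t * S| <
        M * Real.exp (α * t) * (n : ℝ) ^ α * L + lam * Real.exp t := by
  have hn0 : (0 : ℝ) < n := by exact_mod_cast hn
  have hx : 0 < Real.exp t * n := mul_pos (Real.exp_pos t) hn0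
  have het := (Real.exp_pos t).ne'
  have heα := (Real.exp_pos (α * t)).ne'
  have hnα := (Real.rpow_pos_of_pos hn0 α).ne'
  have e1 : |primeDensity (Real.exp t * n) - 1 / (n : ℝ) * S| =
      |primePi (Real.exp t * n) - Real.exp t * S| / (Real.exp t * n) := by
    rw [← abs_of_pos hx, ← abs_div, abs_of_pos hx, primeDensity]
    congr 1
    field_simp
  have e2 : M / Real.exp ((1 - α) * t) * (L / (n : ℝ) ^ (1 - α)) + lam / n =
      (M * Real.exp (α * t) * (n : ℝ) ^ α * L + lam * Real.exp t) / (Real.exp t * n) := by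
    rw [sub_mul, one_mul, Real.exp_sub, Real.rpow_sub hn0, Real.rpow_one]
    field_simp
  rw [e1, e2, div_lt_div_iff_of_pos_right hx]

lemma densityLogBound_iff {M α t r lam : ℝ} {n : ℕ} (hn : 1 ≤ n) :
    DensityLogBound M α t r lam n ↔ PiLogBound M α t r lam n :=
  density_bound_iff M α t lam _ _ hn

lemma densityHarmonicBound_iff {M α t r lam : ℝ} {n : ℕ} (hn : 1 ≤ n) :
    DensityHarmonicBound M α t r lam n ↔ PiHarmonicBound M α t r lam n :=
  density_bound_iff M α t lam _ _ hn

lemma PiLogBound.piHarmonicBound {M α t r lam : ℝ} (hM : 0 < M) {n : ℕ} (hn : 1 ≤ n)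
    (h : PiLogBound M α t r lam n) : PiHarmonicBound M α t r lam n := by
  refine lt_of_lt_of_le h ?_
  have := (add_log_lt_shiftedHarmonic t hn).le
  gcongr

/-- The hypothesis on `π - li` is not strict; strictness comes from `|β_n| < β ≤ lam`. -/
lemma piLogBound_of_bound {M C α t r lam : ℝ} (hC : soldner ≤ C)
    (h : ∀ x : ℝ, C ≤ x → |primePi x - li x| ≤ M * x ^ α * Real.log x)
    (hr : soldner * Real.exp (-t) ≤ (⌈r⌉ : ℝ)) (hlam : beta t r ≤ lam) {n : ℕ}
    (hn : C * Real.exp (-t) ≤ n) : PiLogBound M α t r lam n := by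
  have hxC := le_exp_mul hn
  have hx1 : 1 < Real.exp t * n := one_lt_soldner.trans_le (hC.trans hxC)
  have hn0 : (0 : ℝ) < n := by exact_mod_cast one_le_of_one_lt_exp_mul hx1
  have hβ : |betaSeq t r n| < lam := (abs_betaSeq_lt_beta hr
    ((mul_le_mul_of_nonneg_right hC (Real.exp_pos _).le).trans hn)).trans_le hlam
  have h1 := h _ hxC
  rw [exp_mul_rpow t α hn0.le, log_exp_mul hn0, ← mul_assoc] at h1
  have h2 : |li (Real.exp t * n) - Real.exp t * harmonicSum t r n| < lam * Real.exp t := by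
    rw [li_exp_mul_sub_harmonicSum, abs_mul, abs_of_pos (Real.exp_pos t), mul_comm lam]
    exact mul_lt_mul_of_pos_left hβ (Real.exp_pos t)
  exact (abs_sub_le _ _ _).trans_lt (add_lt_add_of_le_of_lt h1 h2)

/-- The bounds at the points `eᵗ n`, with the finite sum replaced by `li`. -/
lemma exists_abs_primePi_sub_li_exp_mul_le {M α t r lam : ℝ} (hM : 0 < M) (hlam : 0 < lam)
    (h : ∀ᶠ n : ℕ in atTop, PiHarmonicBound M α t r lam n) :
    ∃ K : ℝ, 0 < K ∧ ∀ᶠ n : ℕ in atTop, |primePi (Real.exp t * n) - li (Real.exp t * n)| ≤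
      M * Real.exp (α * t) * (n : ℝ) ^ max α 0 * (t + Real.log (n + 1)) + K := by
  have het := Real.exp_pos t
  have hβ := (tendsto_betaSeq t r).abs.eventually (gt_mem_nhds (lt_add_one _))
  refine ⟨lam * Real.exp t + Real.exp t * (|beta t r| + 1), by positivity, ?_⟩
  obtain ⟨N, hN⟩ := exists_nat_gt (Real.exp (-t))
  filter_upwards [h, hβ, eventually_ge_atTop N, eventually_ge_atTop 1] with n h1 h2 h3 h4
  have hn1 : (1 : ℝ) ≤ n := by exact_mod_cast h4
  have hlog : 0 ≤ t + Real.log (n + 1) := by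
    have : Real.exp (-t) ≤ n + 1 := by
      have : (N : ℝ) ≤ n := by exact_mod_cast h3
      linarith
    have := Real.log_le_log (Real.exp_pos _) this
    rw [Real.log_exp] at this
    linarith
  have h5 : shiftedHarmonic t n ≤ t + Real.log (n + 1) := by
    have := harmonic_sub_lt_log_add_one n
    unfold shiftedHarmonic
    linarith
  have h6 : M * Real.exp (α * t) * (n : ℝ) ^ α * shiftedHarmonic t n ≤
      M * Real.exp (α * t) * (n : ℝ) ^ max α 0 * (t + Real.log (n + 1)) := by
    refine (mul_le_mul_of_nonneg_left h5 (by positivity)).trans ?_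
    gcongr
    exact le_max_left _ _
  have h7 : |Real.exp t * harmonicSum t r n - li (Real.exp t * n)| ≤
      Real.exp t * (|beta t r| + 1) := by
    rw [abs_sub_comm, li_exp_mul_sub_harmonicSum, abs_mul, abs_of_pos het]
    exact mul_le_mul_of_nonneg_left h2.le het.le
  have h8 := abs_sub_le (primePi (Real.exp t * n)) (Real.exp t * harmonicSum t r n)
    (li (Real.exp t * n))
  have h9 : _ < _ := h1
  linarith

/-- With `e^t n ≤ x ≤ e^t (n + 1)`, monotonicity squeezes `π x - li x` between the differences at
the endpoints, up to the increment of `li`. -/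
lemma exists_abs_primePi_sub_li_le_of_piHarmonicBound {M α t r lam : ℝ} (hM : 0 < M)
    (hlam : 0 < lam) (h : ∀ᶠ n : ℕ in atTop, PiHarmonicBound M α t r lam n) :
    ∃ M' C' : ℝ, 0 < M' ∧ ∀ x : ℝ, C' ≤ x →
      |primePi x - li x| ≤ M' * x ^ max α 0 * Real.log x := by
  obtain ⟨K, hK, hev⟩ := exists_abs_primePi_sub_li_exp_mul_le hM hlam h
  obtain ⟨N₀, hN₀⟩ := eventually_atTop.1 hev
  have het := Real.exp_pos t
  -- Ensures `e^t n ≥ 3 > e`, so that `log ≥ 1` and `li` grows by at most `e^t` over one step.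
  obtain ⟨N₁, hN₁⟩ := exists_nat_gt (3 * Real.exp (-t))
  set N := max (max N₀ N₁) 1
  set a := max α 0
  have ha : 0 ≤ a := le_max_right _ _
  set P := M * Real.exp (α * t) with hP
  have hP0 : 0 < P := by positivity
  -- From `k ≤ n + 1 ≤ 2 e^{-t} x` and `e^t (k + 1) ≤ 3x ≤ x^2`; the summand `e^t` pays for the
  -- increment of `li`.
  refine ⟨2 * P * (2 * Real.exp (-t)) ^ a + (K + Real.exp t), max 3 (Real.exp t * N),
    by positivity, fun x hx => ?_⟩
  have hx3 : 3 ≤ x := (le_max_left _ _).trans hx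
  have hx0 : 0 < x := by linarith
  set y := x * Real.exp (-t) with hy
  have hxy : Real.exp t * y = x := by
    rw [hy, mul_left_comm, ← Real.exp_add, add_neg_cancel, Real.exp_zero, mul_one]
  have hNy : (N : ℝ) ≤ y := by
    refine le_of_mul_le_mul_left ?_ het
    rw [hxy]
    exact (le_max_right _ _).trans hx
  have hy0 : 0 ≤ y := (Nat.cast_nonneg N).trans hNy
  set n := ⌊y⌋₊ with hn
  have hNn : N ≤ n := Nat.le_floor hNy
  have hny : (n : ℝ) ≤ y := Nat.floor_le hy0
  have hyn : y < n + 1 := Nat.lt_floor_add_one y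
  have hn1 : (1 : ℝ) ≤ n := by exact_mod_cast (le_max_right _ _).trans hNn
  have h3n : 3 ≤ Real.exp t * n := by
    refine le_exp_mul (hN₁.le.trans ?_)
    exact_mod_cast (((le_max_right _ _).trans (le_max_left _ _)).trans hNn)
  have hlogx : 1 ≤ Real.log x := by
    rw [Real.le_log_iff_exp_le hx0]
    linarith [Real.exp_one_lt_d9]
  have hpt : ∀ k : ℕ, n ≤ k → (k : ℝ) ≤ n + 1 →
      |primePi (Real.exp t * k) - li (Real.exp t * k)| ≤
        2 * P * (2 * Real.exp (-t)) ^ a * (x ^ a * Real.log x) + K := by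
    intro k hk hk'
    refine (hN₀ k ((((le_max_left _ _).trans (le_max_left _ _)).trans hNn).trans hk)).trans ?_
    have hk2 : (k : ℝ) ≤ 2 * Real.exp (-t) * x := by
      rw [mul_assoc, mul_comm _ x]
      linarith
    have hpow : (k : ℝ) ^ a ≤ (2 * Real.exp (-t)) ^ a * x ^ a := by
      rw [← Real.mul_rpow (by positivity) hx0.le]
      gcongr
    have hlog : t + Real.log (k + 1) ≤ 2 * Real.log x := by
      have h1 : (k : ℝ) + 1 ≤ 3 * y := by linarith
      have h2 : t + Real.log (k + 1) = Real.log (Real.exp t * (k + 1)) :=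
        (log_exp_mul (by positivity)).symm
      have h3 : Real.exp t * (k + 1) ≤ x ^ 2 := by
        calc Real.exp t * (k + 1) ≤ Real.exp t * (3 * y) := by gcongr
          _ = 3 * x := by rw [← hxy]; ring
          _ ≤ x ^ 2 := by nlinarith
      rw [h2, show 2 * Real.log x = Real.log (x ^ 2) by rw [Real.log_pow]; norm_num]
      exact Real.log_le_log (by positivity) h3
    have hlog0 : 0 ≤ t + Real.log (k + 1) := by
      have hnk : (n : ℝ) ≤ k + 1 := by
        have : (n : ℝ) ≤ k := by exact_mod_cast hk
        linarith
      exact (add_log_pos (one_lt_exp_mul_of_le (by linarith) hnk)).le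
    calc P * (k : ℝ) ^ a * (t + Real.log (k + 1)) + K
        ≤ P * ((2 * Real.exp (-t)) ^ a * x ^ a) * (2 * Real.log x) + K := by gcongr
      _ = _ := by ring
  have hgap : li (Real.exp t * (n + 1)) - li (Real.exp t * n) ≤ Real.exp t := by
    have h1 : 1 < Real.exp t * n := by linarith
    have h2 := (li_exp_mul_sub h1 (show (n : ℝ) ≤ n + 1 by linarith)).trans_le
      (integral_one_div_add_log_le h1)
    have h3 : 1 / (t + Real.log n) ≤ 1 := by
      rw [← log_exp_mul (by linarith)]
      refine (div_le_one (Real.log_pos h1)).2 ?_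
      rw [Real.le_log_iff_exp_le (by linarith)]
      linarith [Real.exp_one_lt_d9]
    rw [← sub_div] at h2
    exact (div_le_one het).1 (h2.trans h3)
  have hxn : Real.exp t * n ≤ x := by rw [← hxy]; gcongr
  have hxn' : x ≤ Real.exp t * (n + 1) := by rw [← hxy]; gcongr
  have e0 := abs_le.1 (hpt n le_rfl (by linarith))
  have e1 := abs_le.1 (hpt (n + 1) (Nat.le_succ n) (by push_cast; exact le_rfl))
  push_cast at e1
  have p0 := primePi_mono hxn
  have p1 := primePi_mono hxn'
  have l0 := li_le_li (by linarith) hxn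
  have l1 := li_le_li (by linarith) hxn'
  have hxa : 1 ≤ x ^ a * Real.log x :=
    one_le_mul_of_one_le_of_one_le (Real.one_le_rpow (by linarith) ha) hlogx
  have hfin : K + Real.exp t ≤ (K + Real.exp t) * (x ^ a * Real.log x) :=
    le_mul_of_one_le_right (by positivity) hxa
  have hfin' : (2 * P * (2 * Real.exp (-t)) ^ a + (K + Real.exp t)) * x ^ a * Real.log x =
      2 * P * (2 * Real.exp (-t)) ^ a * (x ^ a * Real.log x) +
        (K + Real.exp t) * (x ^ a * Real.log x) := by ring
  rw [hfin', abs_le]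
  constructor <;> linarith [e0.1, e0.2, e1.1, e1.2]

theorem converse_of_piHarmonicBound {M α t r lam : ℝ} (hM : 0 < M)
    (hlam : 0 < lam) (h : ∀ᶠ n : ℕ in atTop, PiHarmonicBound M α t r lam n) :
    zetaZeroSup ≤ α ∧ ∃ M' C' : ℝ, 0 < M' ∧ soldner ≤ C' ∧
      ∀ x : ℝ, C' ≤ x → |primePi x - li x| ≤ M' * x ^ α * Real.log x := by
  obtain ⟨M', C', hM', hb⟩ := exists_abs_primePi_sub_li_le_of_piHarmonicBound hM hlam h
  obtain ⟨h1, h2⟩ := half_le_and_zetaZeroSup_le hM' hb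
  -- The exponent `max α 0` was used to absorb constants; `1/2 ≤ max α 0` now rules out `α < 0`.
  have hα : max α 0 = α := by
    refine max_eq_left ?_
    by_contra! hlt
    rw [max_eq_right hlt.le] at h1
    norm_num at h1
  rw [hα] at hb h2
  exact ⟨h2, M', max C' soldner, hM', le_max_right _ _,
    fun x hx => hb x ((le_max_left _ _).trans hx)⟩

end HarmonicPrimes

theorem theorem4p3 :
    -- the forward direction
    (∀ M C α : ℝ, 0 < M → HarmonicPrimes.soldner ≤ C →
      (∀ x : ℝ, C ≤ x →
        |HarmonicPrimes.primePi x - HarmonicPrimes.li x| ≤ M * x ^ α * Real.log x) →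
      HarmonicPrimes.zetaZeroSup ≤ α ∧
      ∀ t r : ℝ, HarmonicPrimes.soldner * Real.exp (-t) ≤ (⌈r⌉ : ℝ) →
        -- the limit that defines `β(t, r)` exists
        Tendsto (HarmonicPrimes.betaSeq t r) atTop (𝓝 (HarmonicPrimes.beta t r)) ∧
        ∀ lam : ℝ, HarmonicPrimes.beta t r ≤ lam →
          ∀ n : ℕ, C * Real.exp (-t) ≤ (n : ℝ) →
            HarmonicPrimes.PiLogBound M α t r lam n ∧
            HarmonicPrimes.PiHarmonicBound M α t r lam n ∧
            HarmonicPrimes.DensityLogBound M α t r lam n ∧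
            HarmonicPrimes.DensityHarmonicBound M α t r lam n) ∧
    -- the converse
    (∀ M C lam t r α : ℝ, 0 < M → HarmonicPrimes.soldner ≤ C → 0 < lam →
      ((∀ n : ℕ, C ≤ (n : ℝ) → HarmonicPrimes.PiLogBound M α t r lam n) ∨
       (∀ n : ℕ, C ≤ (n : ℝ) → HarmonicPrimes.PiHarmonicBound M α t r lam n) ∨
       (∀ n : ℕ, C ≤ (n : ℝ) → HarmonicPrimes.DensityLogBound M α t r lam n) ∨
       (∀ n : ℕ, C ≤ (n : ℝ) → HarmonicPrimes.DensityHarmonicBound M α t r lam n)) →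
      HarmonicPrimes.zetaZeroSup ≤ α ∧
      ∃ M' C' : ℝ, 0 < M' ∧ HarmonicPrimes.soldner ≤ C' ∧
        ∀ x : ℝ, C' ≤ x →
          |HarmonicPrimes.primePi x - HarmonicPrimes.li x| ≤ M' * x ^ α * Real.log x) := by
  refine ⟨fun M C α hM hC h => ?_, fun M C lam t r α hM hC hlam h => ?_⟩
  · refine ⟨(HarmonicPrimes.half_le_and_zetaZeroSup_le hM h).2, fun t r hr =>
      ⟨HarmonicPrimes.tendsto_betaSeq t r, fun lam hlam n hn => ?_⟩⟩
    have h1 := HarmonicPrimes.piLogBound_of_bound hC h hr hlam hn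
    have hn1 : 1 ≤ n := HarmonicPrimes.one_le_of_one_lt_exp_mul
      (HarmonicPrimes.one_lt_soldner.trans_le (hC.trans (HarmonicPrimes.le_exp_mul hn)))
    have h2 := h1.piHarmonicBound hM hn1
    exact ⟨h1, h2, (HarmonicPrimes.densityLogBound_iff hn1).2 h1,
      (HarmonicPrimes.densityHarmonicBound_iff hn1).2 h2⟩
  · refine HarmonicPrimes.converse_of_piHarmonicBound (t := t) (r := r) hM hlam ?_
    filter_upwards [eventually_ge_atTop 1, eventually_ge_atTop ⌈C⌉₊] with n hn1 hn
    have hn' : C ≤ n := Nat.ceil_le.1 hn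
    rcases h with h | h | h | h
    · exact (h n hn').piHarmonicBound hM hn1
    · exact h n hn'
    · exact ((HarmonicPrimes.densityLogBound_iff hn1).1 (h n hn')).piHarmonicBound hM hn1
    · exact (HarmonicPrimes.densityHarmonicBound_iff hn1).1 (h n hn')
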